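/- Let $r_*>0$. Let $$\mathcal P=\{r_*\,\mathbf n\otimes\mathbf n:\ \mathbf n\in\mathbb S^2\},\qquad \mathcal N=\{r_*(\mathbf n\otimes\mathbf n-\mathbf m\otimes\mathbf m):\ \mathbf n,\mathbf m\in\mathbb S^2,\ \mathbf n\cdot\mathbf m=0\},$$ viewed as subsets of the space of real $3\times3$ matrices with the norm $|\mathbf A|^2=\sum_{i,j}\mathbf A_{ij}^2$. For $\mathcal X\in\{\mathcal P,\mathcal N\}$ let $[\mathbb S^1,\mathcal X]$ be the set of free homotopy classes $[\alpha]_{\mathcal X}$ of loops $\alpha\in C^0(\mathbb S^1,\mathcal X)$, where $\mathbb S^1=\mathbb R/2\pi\mathbb Z$. For $c\in[\mathbb S^1,\mathcal X]$ define $$\mathcal E(c)=\inf\Big\{\tfrac12\int_0^{2\pi}|\beta'(\theta)|^2\,\mathrm d\theta:\ \beta\in H^1(\mathbb S^1,\mathcal X),\ [\beta]_{\mathcal X}=c\Big\}$$ and, for a base point $x_0\in\mathcal X$, $$\mathcal E^*(c)=\inf\Big\{\sum_{i=1}^n\mathcal E([\alpha_i]_{\mathcal X}):\ n\ge1,\ \alpha_1,\dots,\alpha_n\text{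 loops in }\mathcal X\text{ based at }x_0,\ [\alpha_1*\cdots*\alpha_n]_{\mathcal X}=c\Big\},$$ where $*$ is concatenation of loops and $\inf\emptyset=+\infty$ (the value does not depend on $x_0$; the assertions below hold for every choice of base points in $\mathcal P$ and in $\mathcal N$). Let $\mathrm h_1\in[\mathbb S^1,\mathcal P]$ be the class of non-trivial loops, that is, the class of $\theta\mapsto r_*\,\mathbf n(\theta)\otimes\mathbf n(\theta)$ with $\mathbf n(\theta)=(\cos\frac\theta2,\sin\frac\theta2,0)^{\mathrm T}$, and put $\kappa_*=\mathcal E^*(\mathrm h_1)$. Let $\mathbf e^{(1)}=(1,0,0)^{\mathrm T}$, $\mathbf e^{(2)}=(0,1,0)^{\mathrm T}$, and consider the loops in $\mathcal N$ based at $\mathbf X_0=r_*(\mathbf e^{(1)}\otimes\mathbf e^{(1)}-\mathbf e^{(2)}\otimes\mathbf e^{(2)})$ given for $\theta\in[0,2\pi]$ by $$\mathbf A(\theta)=r_*\big(\mathbf e^{(1)}\otimes\mathbf e^{(1)}-\mathbf n(\theta)\otimes\mathbf n(\theta)\big),\quad \mathbf n(\theta)=(0,\cos\tfrac\theta2,\sin\tfrac\theta2)^{\mathrm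 T},$$ $$\mathbf B(\theta)=r_*\big(\mathbf m(\theta)\otimes\mathbf m(\theta)-\mathbf e^{(2)}\otimes\mathbf e^{(2)}\big),\quad \mathbf m(\theta)=(\cos\tfrac\theta2,0,\sin\tfrac\theta2)^{\mathrm T}.$$ Let $\mathrm H_0,\mathrm H_1,\mathrm H_2,\mathrm H_3,\mathrm H_4\in[\mathbb S^1,\mathcal N]$ be the free homotopy classes of the constant loop $\mathbf X_0$, of $\mathbf A$, of $\mathbf B$, of $\mathbf A*\mathbf B$ and of $\mathbf A*\mathbf A$, respectively. (Under the isomorphism of $\pi_1(\mathcal N,\mathbf X_0)$ with the quaternion group $Q_8$ that sends $[\mathbf A]$ to $\mathrm i$ and $[\mathbf B]$ to $\mathrm j$, they correspond to the conjugacy classes $\{1\},\{\pm\mathrm i\},\{\pm\mathrm j\},\{\pm\mathrm k\},\{-1\}$.) Then: 1. $\mathcal E(\mathrm H_0)=0$, $\ \mathcal E(\mathrm H_1)=\mathcal E(\mathrm H_2)=\kappa_*$, $\ 2\kappa_*<\mathcal E(\mathrm H_3)<4\kappa_*$ and $\mathcal E(\mathrm H_4)=4\kappa_*$. 2. $\mathcal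 E^*(\mathrm H_0)=0$, $\ \mathcal E^*(\mathrm H_1)=\mathcal E^*(\mathrm H_2)=\kappa_*$ and $\mathcal E^*(\mathrm H_3)=\mathcal E^*(\mathrm H_4)=2\kappa_*$. -/

import Mathlib

open MeasureTheory Matrix
open scoped ENNReal

noncomputable section

namespace LoopEnergy

instance factTwoPiPos : Fact (0 < 2 * Real.pi) := ⟨Real.two_pi_pos⟩

/-- Real `3 × 3` matrices, with their usual (product) topology. -/
abbrev Mat3 : Type := Matrix (Fin 3) (Fin 3) ℝ

/-! ### Loops and free homotopy classes

The circle is `ℝ / 2πℤ`; a loop is a continuous map from the circle. -/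

/-- `C⁰(𝕊¹, X)`. -/
abbrev Loop (X : Type*) [TopologicalSpace X] : Type _ :=
  C(AddCircle (2 * Real.pi), X)

/-- Free homotopy of loops (no condition on base points). -/
def freeSetoid (X : Type*) [TopologicalSpace X] : Setoid (Loop X) where
  r := ContinuousMap.Homotopic
  iseqv := ContinuousMap.Homotopic.equivalence

/-- The set `[𝕊¹, X]` of free homotopy classes of loops in `X`. -/
abbrev FreeClass (X : Type*) [TopologicalSpace X] : Type _ :=
  Quotient (freeSetoid X)

/-- The class `[α]_X` of a loop `α`. -/
def freeClass {X : Type*} [TopologicalSpace X] (α : Loop X) : FreeClass X :=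
  Quotient.mk (freeSetoid X) α

/-- The loop on `ℝ / 2πℤ` given by a path `γ : [0,1] → X` with `γ 0 = γ 1 = x`:
its value at the class of `θ ∈ [0, 2π]` is `γ (θ / 2π)`. -/
def toLoop {X : Type*} [TopologicalSpace X] {x : X} (γ : Path x x) : Loop X where
  toFun := AddCircle.liftIco (2 * Real.pi) 0 fun θ => γ.extend (θ / (2 * Real.pi))
  continuous_toFun := by
    refine AddCircle.liftIco_zero_continuous ?_ ?_
    · simp
    · exact (γ.continuous_extend.comp (continuous_id.div_const _)).continuousOn

theorem toLoop_apply {X : Type*} [TopologicalSpace X] {x : X} (γ : Path x x)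
    {θ : ℝ} (hθ : θ ∈ Set.Icc 0 (2 * Real.pi)) :
    toLoop γ (θ : AddCircle (2 * Real.pi)) = γ.extend (θ / (2 * Real.pi)) := by
  rcases hθ.2.lt_or_eq with h | h
  · exact AddCircle.liftIco_zero_coe_apply
      (f := fun θ => γ.extend (θ / (2 * Real.pi))) ⟨hθ.1, h⟩
  · have h0 : toLoop γ ((0 : ℝ) : AddCircle (2 * Real.pi)) = γ.extend (0 / (2 * Real.pi)) :=
      AddCircle.liftIco_zero_coe_apply
        (f := fun θ => γ.extend (θ / (2 * Real.pi))) ⟨le_rfl, Real.two_pi_pos⟩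
    have h1 : ((2 * Real.pi : ℝ) : AddCircle (2 * Real.pi)) =
        ((0 : ℝ) : AddCircle (2 * Real.pi)) := by
      simp [AddCircle.coe_period]
    rw [h, h1, h0]
    simp

theorem toLoop_homotopic {X : Type*} [TopologicalSpace X] {x : X} {γ γ' : Path x x}
    (h : γ.Homotopic γ') : (toLoop γ).Homotopic (toLoop γ') := by
  obtain ⟨F⟩ := h
  -- the homotopy, read as a loop in the space of maps from the unit interval to `X`
  let G : C(unitInterval, C(unitInterval, X)) :=
    (F.toContinuousMap.comp ContinuousMap.prodSwap).curry
  let g : Path (ContinuousMap.const unitInterval x) (ContinuousMap.const unitInterval x) :=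
    { toFun := G
      continuous_toFun := G.continuous
      source' := by ext s; simp [G]
      target' := by ext s; simp [G] }
  have key : ∀ (s : unitInterval) (q : AddCircle (2 * Real.pi)) (δ : Path x x),
      (∀ t, F (s, t) = δ t) → toLoop g q s = toLoop δ q := by
    intro s q δ hδ
    obtain ⟨θ, hθ, rfl⟩ := AddCircle.eq_coe_Ico q
    rw [toLoop_apply g ⟨hθ.1, hθ.2.le⟩, toLoop_apply δ ⟨hθ.1, hθ.2.le⟩]
    simp only [Path.extend, Set.IccExtend]
    exact hδ _
  refine ⟨⟨⟨fun z => toLoop g z.2 z.1, ?_⟩, fun q => ?_, fun q => ?_⟩⟩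
  · exact continuous_eval.comp
      (((toLoop g).continuous.comp continuous_snd).prodMk continuous_fst)
  · exact key 0 q γ fun t => by simp
  · exact key 1 q γ' fun t => by simp

/-- The natural map `π₁(X, x) → [𝕊¹, X]` that forgets the base point. -/
def forgetBase {X : Type*} [TopologicalSpace X] {x : X} :
    FundamentalGroup X x → FreeClass X :=
  Quotient.lift (fun γ : Path x x => freeClass (toLoop γ))
    fun _ _ h => Quotient.sound (s := freeSetoid X) (toLoop_homotopic h)

/-! ### Energies of free homotopy classes

`X` is a set of real `3 × 3` matrices, with the Euclidean norm `|A|² = ∑ᵢⱼ Aᵢⱼ²`. -/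

/-- The loop `β` belongs to `H¹(𝕊¹, X)` and its derivative is `g`: the function `g` is square
integrable on `[0, 2π]` and `β` is its indefinite integral. -/
def HasH1Deriv {X : Set Mat3} (β : Loop X) (g : ℝ → Mat3) : Prop :=
  (∀ i j, MemLp (fun s => g s i j) 2 (volume.restrict (Set.Ioc 0 (2 * Real.pi)))) ∧
  ∀ θ ∈ Set.Icc (0 : ℝ) (2 * Real.pi), ∀ i j,
    (β (θ : AddCircle (2 * Real.pi)) : Mat3) i j =
      (β ((0 : ℝ) : AddCircle (2 * Real.pi)) : Mat3) i j + ∫ s in (0 : ℝ)..θ, g s i j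

/-- `½ ∫₀^{2π} |g|²`. -/
def dirichlet (g : ℝ → Mat3) : ℝ :=
  (1 / 2) * ∫ s in (0 : ℝ)..(2 * Real.pi), ∑ i, ∑ j, (g s i j) ^ 2

/-- The minimal energy `𝓔` of a free homotopy class: the infimum (in `[0, ∞]`) of
`½ ∫ |β'|²` over the loops `β ∈ H¹(𝕊¹, X)` in the class. -/
def energy {X : Set Mat3} (c : FreeClass X) : ℝ≥0∞ :=
  ⨅ (β : Loop X) (g : ℝ → Mat3) (_ : freeClass β = c) (_ : HasH1Deriv β g),
    ENNReal.ofReal (dirichlet g)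

/-- The decomposed energy `𝓔*` of a free homotopy class, with respect to the base point `x₀`:
the infimum (in `[0, ∞]`) of `∑ᵢ 𝓔([αᵢ])` over all finite nonempty families `α₁, …, αₙ` in
`π₁(X, x₀)` whose product lies in the class. (The product in `FundamentalGroup` is concatenation
in the opposite order; as all finite sequences are allowed, this has no influence.) -/
def decomposedEnergy {X : Set Mat3} (x₀ : X) (c : FreeClass X) : ℝ≥0∞ :=
  ⨅ (l : List (FundamentalGroup X x₀)) (_ : l ≠ []) (_ : forgetBase l.prod = c),
    (l.map fun a => energy (forgetBase a)).sum

/-! ### The manifolds `𝒫` and `𝒩` -/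

/-- `𝒫 = {r n⊗n : n ∈ 𝕊²}`. -/
def mfdP (r : ℝ) : Set Mat3 :=
  {Q | ∃ n : Fin 3 → ℝ, n ⬝ᵥ n = 1 ∧ Q = r • vecMulVec n n}

/-- `𝒩 = {r (n⊗n - m⊗m) : n, m ∈ 𝕊², n · m = 0}`. -/
def mfdN (r : ℝ) : Set Mat3 :=
  {Q | ∃ n m : Fin 3 → ℝ, n ⬝ᵥ n = 1 ∧ m ⬝ᵥ m = 1 ∧ n ⬝ᵥ m = 0 ∧
    Q = r • (vecMulVec n n - vecMulVec m m)}

/-! ### The classes `h₁` in `[𝕊¹, 𝒫]` and `H₀, …, H₄` in `[𝕊¹, 𝒩]` -/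

/-- `e⁽¹⁾`. -/
def e1 : Fin 3 → ℝ := ![1, 0, 0]

/-- `e⁽²⁾`. -/
def e2 : Fin 3 → ℝ := ![0, 1, 0]

/-- `(cos πt, sin πt, 0)`; with `t = θ / 2π` this is `(cos (θ/2), sin (θ/2), 0)`. -/
def halfCircle12 (t : ℝ) : Fin 3 → ℝ := ![Real.cos (Real.pi * t), Real.sin (Real.pi * t), 0]

/-- `(0, cos πt, sin πt)`; with `t = θ / 2π` this is `(0, cos (θ/2), sin (θ/2))`. -/
def halfCircle23 (t : ℝ) : Fin 3 → ℝ := ![0, Real.cos (Real.pi * t), Real.sin (Real.pi * t)]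

/-- `(cos πt, 0, sin πt)`; with `t = θ / 2π` this is `(cos (θ/2), 0, sin (θ/2))`. -/
def halfCircle13 (t : ℝ) : Fin 3 → ℝ := ![Real.cos (Real.pi * t), 0, Real.sin (Real.pi * t)]

/-- The point `r e⁽¹⁾⊗e⁽¹⁾` of `𝒫`. -/
def baseP (r : ℝ) : mfdP r :=
  ⟨r • vecMulVec e1 e1, e1, by simp [e1, dotProduct, Fin.sum_univ_three], rfl⟩

/-- The point `r (e⁽¹⁾⊗e⁽¹⁾ - e⁽²⁾⊗e⁽²⁾)` of `𝒩`. -/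
def baseN (r : ℝ) : mfdN r :=
  ⟨r • (vecMulVec e1 e1 - vecMulVec e2 e2), e1, e2,
    by simp [e1, dotProduct, Fin.sum_univ_three],
    by simp [e2, dotProduct, Fin.sum_univ_three],
    by simp [e1, e2, dotProduct, Fin.sum_univ_three], rfl⟩

/-- The loop `r n⊗n` in `𝒫` where `n` runs through half of a great circle. -/
def pathP (r : ℝ) : Path (baseP r) (baseP r) where
  toFun t := ⟨r • vecMulVec (halfCircle12 t) (halfCircle12 t), halfCircle12 t, by
    simp only [halfCircle12, dotProduct, Fin.sum_univ_three]
    simp only [cons_val_zero, cons_val_one, cons_val]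
    nlinarith [Real.sin_sq_add_cos_sq (Real.pi * t)], rfl⟩
  continuous_toFun := by
    refine Continuous.subtype_mk (continuous_matrix fun i j => ?_) _
    fin_cases i <;> fin_cases j <;> simp [halfCircle12] <;> fun_prop
  source' := by
    refine Subtype.ext (Matrix.ext fun i j => ?_)
    fin_cases i <;> fin_cases j <;> simp [halfCircle12, baseP, e1]
  target' := by
    refine Subtype.ext (Matrix.ext fun i j => ?_)
    fin_cases i <;> fin_cases j <;> simp [halfCircle12, baseP, e1]

/-- The loop `A = r (e⁽¹⁾⊗e⁽¹⁾ - n⊗n)` in `𝒩`, `n(θ) = (0, cos (θ/2), sin (θ/2))`. -/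
def pathA (r : ℝ) : Path (baseN r) (baseN r) where
  toFun t := ⟨r • (vecMulVec e1 e1 - vecMulVec (halfCircle23 t) (halfCircle23 t)),
    e1, halfCircle23 t,
    by simp [e1, dotProduct, Fin.sum_univ_three],
    by
      simp only [halfCircle23, dotProduct, Fin.sum_univ_three]
      simp only [cons_val_zero, cons_val_one, cons_val]
      nlinarith [Real.sin_sq_add_cos_sq (Real.pi * t)],
    by simp [e1, halfCircle23, dotProduct, Fin.sum_univ_three], rfl⟩
  continuous_toFun := by
    refine Continuous.subtype_mk (continuous_matrix fun i j => ?_) _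
    fin_cases i <;> fin_cases j <;> simp [halfCircle23, e1] <;> fun_prop
  source' := by
    refine Subtype.ext (Matrix.ext fun i j => ?_)
    fin_cases i <;> fin_cases j <;> simp [halfCircle23, baseN, e1, e2]
  target' := by
    refine Subtype.ext (Matrix.ext fun i j => ?_)
    fin_cases i <;> fin_cases j <;> simp [halfCircle23, baseN, e1, e2]

/-- The loop `B = r (m⊗m - e⁽²⁾⊗e⁽²⁾)` in `𝒩`, `m(θ) = (cos (θ/2), 0, sin (θ/2))`. -/
def pathB (r : ℝ) : Path (baseN r) (baseN r) where
  toFun t := ⟨r • (vecMulVec (halfCircle13 t) (halfCircle13 t) - vecMulVec e2 e2),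
    halfCircle13 t, e2,
    by
      simp only [halfCircle13, dotProduct, Fin.sum_univ_three]
      simp only [cons_val_zero, cons_val_one, cons_val]
      nlinarith [Real.sin_sq_add_cos_sq (Real.pi * t)],
    by simp [e2, dotProduct, Fin.sum_univ_three],
    by simp [e2, halfCircle13, dotProduct, Fin.sum_univ_three], rfl⟩
  continuous_toFun := by
    refine Continuous.subtype_mk (continuous_matrix fun i j => ?_) _
    fin_cases i <;> fin_cases j <;> simp [halfCircle13, e2] <;> fun_prop
  source' := by
    refine Subtype.ext (Matrix.ext fun i j => ?_)
    fin_cases i <;> fin_cases j <;> simp [halfCircle13, baseN, e1, e2]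
  target' := by
    refine Subtype.ext (Matrix.ext fun i j => ?_)
    fin_cases i <;> fin_cases j <;> simp [halfCircle13, baseN, e1, e2]

/-- `h₁`, the class of non-trivial loops in `𝒫` (a projective plane): the class of the loop
traced by half of a great circle. -/
def h1 (r : ℝ) : FreeClass (mfdP r) := freeClass (toLoop (pathP r))

/- Under the isomorphism `Q₈ ≅ π₁(𝒩, X₀)` determined by `i ↦ [A]`, `j ↦ [B]`, the free classes
below correspond to the conjugacy classes `{1}`, `{±i}`, `{±j}`, `{±k}`, `{-1}`, through their
elements `1`, `i`, `j`, `k = ij` and `-1 = i²`. -/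

/-- `H₀`, the class of the constant loops. -/
def H0 (r : ℝ) : FreeClass (mfdN r) := freeClass (ContinuousMap.const _ (baseN r))

/-- `H₁`, corresponding to `{±i}`. -/
def H1 (r : ℝ) : FreeClass (mfdN r) := freeClass (toLoop (pathA r))

/-- `H₂`, corresponding to `{±j}`. -/
def H2 (r : ℝ) : FreeClass (mfdN r) := freeClass (toLoop (pathB r))

/-- `H₃`, corresponding to `{±k}`. -/
def H3 (r : ℝ) : FreeClass (mfdN r) := freeClass (toLoop ((pathA r).trans (pathB r)))

/-- `H₄`, corresponding to `{-1}`. -/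
def H4 (r : ℝ) : FreeClass (mfdN r) := freeClass (toLoop ((pathA r).trans (pathA r)))

/-- `κ_* = 𝓔*(h₁)`, with the base point `p₀ ∈ 𝒫` used for `𝓔*`. -/
def kappaStar {r : ℝ} (p₀ : mfdP r) : ℝ≥0∞ := decomposedEnergy p₀ (h1 r)

end LoopEnergy

end

/-! Both manifolds are orbits of the rotation group and have finite coverings: `covP` maps `𝕊²` onto
`𝒫` with deck group `{1, -1}`, and `covN` maps the unit quaternions onto `𝒩` with deck group `{±1,
±i, ±j, ±k}`, acting by left multiplication. The free class of a loop determines the monodromy of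
its lifts up to conjugation (`isConj_of_hasMonodromy`), so a lower bound for the energy of a class
is a bound for curves on a sphere that join a point to its image under a given deck transformation.

If `b, c, d` are the components of the velocity `q' q⁻¹` along `i, j, k`, the metric pulled back by
`covN` is `8r²(b² + c² + 4d²)`. It dominates `8r²` times the round metric, for which `±i, ±j` move
every point by the angle `π/2` and `-1` moves it by `π`; this yields `πr²/2 = κ_*` and `4κ_*`. For
`±k` the round metric yields only `κ_*`, and the factor 4 has to be used. Replacing `q(t)` by
`exp(τtk) q(t)` changes `d` into `d + τ`, and `(d + τ)² ≤ 4d² + 4τ²/3`. With `τ = ±π/2` the new end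
points are antipodal, and `π² - (4/3)(π/2)² = (8/3)(π/2)²` yields `(8/3)κ_* > 2κ_*`
(`le_dirichlet_of_lift`, `weight_mul_le_dirichlet`). Explicit loops of constant speed attain the
bounds for `H₀, H₁, H₂, H₄`; for `H₃` a tilted rotation has energy `(68/25)κ_* < 4κ_*`
(`energy_H3_le`).

For the decomposed energy, `starWeight` is the word length with respect to `±i, ±j`: it is
conjugation invariant, subadditive and at most `weight`, so it bounds every decomposition from below
(`le_decomposedEnergy`). The loops `A`, `B` and their concatenations attain this bound.

Lifts are only known to be continuous. Lengths are therefore compared through chords over fine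
partitions (`sum_frobSq_le`, `le_dirichlet_of_forall_compare`). -/

noncomputable section

namespace LoopEnergy

open scoped unitInterval Quaternion

/-! ### Discrete energies of `H¹` loops -/

/-- The Cauchy-Schwarz inequality for the mean of a square integrable function. -/
theorem sq_intervalIntegral_le {f : ℝ → ℝ} {a b : ℝ} (hab : a ≤ b)
    (hf : MemLp f 2 (volume.restrict (Set.Ioc a b))) :
    (∫ s in a..b, f s) ^ 2 ≤ (b - a) * ∫ s in a..b, f s ^ 2 := by
  rcases hab.eq_or_lt with rfl | hlt
  · simp
  have h1 : IntervalIntegrable f volume a b :=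
    (intervalIntegrable_iff_integrableOn_Ioc_of_le hab).2 (hf.integrable (by norm_num))
  have h2 : IntervalIntegrable (fun s => f s ^ 2) volume a b :=
    (intervalIntegrable_iff_integrableOn_Ioc_of_le hab).2 hf.integrable_sq
  set c := (∫ s in a..b, f s) / (b - a) with hc
  have h0 : 0 ≤ ∫ s in a..b, (f s - c) ^ 2 :=
    intervalIntegral.integral_nonneg hab fun s _ => sq_nonneg _
  have e : (fun s => (f s - c) ^ 2) = fun s => f s ^ 2 - 2 * c * f s + c ^ 2 := by
    ext s; ring
  rw [e, intervalIntegral.integral_add (h2.sub (h1.const_mul _)) (by simp),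
    intervalIntegral.integral_sub h2 (h1.const_mul _), intervalIntegral.integral_const_mul,
    intervalIntegral.integral_const, smul_eq_mul] at h0
  have hpos : 0 < b - a := sub_pos.2 hlt
  have hI : ∫ s in a..b, f s = c * (b - a) := by rw [hc]; field_simp
  rw [hI] at h0 ⊢
  nlinarith

/-- The squared Euclidean norm of a matrix. -/
def frobSq (M : Mat3) : ℝ := ∑ i, ∑ j, M i j ^ 2

/-- The point of the circle with angle `2πt`. -/
def circlePt (t : ℝ) : AddCircle (2 * Real.pi) := ((2 * Real.pi * t : ℝ) : AddCircle (2 * Real.pi))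

theorem circlePt_one : circlePt 1 = circlePt 0 := by
  simp [circlePt, AddCircle.coe_period]

theorem continuous_circlePt : Continuous circlePt := by
  unfold circlePt
  exact (AddCircle.continuous_mk' _).comp (continuous_const.mul continuous_id)

/-- The discrete energies of a loop are bounded by its Dirichlet energy. -/
theorem sum_frobSq_le {X : Set Mat3} {β : Loop X} {g : ℝ → Mat3} (h : HasH1Deriv β g)
    {N : ℕ} (hN : 0 < N) :
    N * ∑ k ∈ Finset.range N, frobSq ((β (circlePt ((k + 1 : ℕ) / N)) : Mat3) -
      (β (circlePt ((k : ℕ) / N)) : Mat3)) ≤ 4 * Real.pi * dirichlet g := by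
  obtain ⟨hL, hI⟩ := h
  have hN' : (0 : ℝ) < N := by exact_mod_cast hN
  have hpi := Real.pi_pos
  set a : ℕ → ℝ := fun k => 2 * Real.pi * (k / N) with ha
  have ha0 : a 0 = 0 := by simp [ha]
  have haN : a N = 2 * Real.pi := by simp [ha, hN'.ne']
  have hamono : Monotone a := fun m n hmn => by
    have : (m : ℝ) ≤ n := by exact_mod_cast hmn
    simp only [ha]; gcongr
  have hstep : ∀ k, a (k + 1) - a k = 2 * Real.pi / N := fun k => by
    simp only [ha]; push_cast; field_simp; ring
  have hmem : ∀ k ≤ N, a k ∈ Set.Icc (0 : ℝ) (2 * Real.pi) := fun k hk =>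
    ⟨ha0 ▸ hamono (Nat.zero_le k), haN ▸ hamono hk⟩
  have hint : ∀ i j, IntervalIntegrable (fun s => g s i j) volume 0 (2 * Real.pi) := fun i j =>
    (intervalIntegrable_iff_integrableOn_Ioc_of_le Real.two_pi_pos.le).2
      ((hL i j).integrable (by norm_num))
  have hint2 : ∀ i j, IntervalIntegrable (fun s => g s i j ^ 2) volume 0 (2 * Real.pi) :=
    fun i j => (intervalIntegrable_iff_integrableOn_Ioc_of_le Real.two_pi_pos.le).2
      (hL i j).integrable_sq
  have hsub : ∀ {f : ℝ → ℝ}, IntervalIntegrable f volume 0 (2 * Real.pi) → ∀ k ≤ N, ∀ l ≤ N,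
      IntervalIntegrable f volume (a k) (a l) := fun hf k hk l hl =>
    hf.mono_set (by
      rw [Set.uIcc_of_le Real.two_pi_pos.le]
      exact Set.uIcc_subset_Icc (hmem k hk) (hmem l hl))
  have key : ∀ k < N, ∀ i j,
      ((β (circlePt ((k + 1 : ℕ) / N)) : Mat3) - (β (circlePt ((k : ℕ) / N)) : Mat3)) i j ^ 2 ≤
        2 * Real.pi / N * ∫ s in (a k)..(a (k + 1)), g s i j ^ 2 := by
    intro k hk i j
    have e1 := hI (a (k + 1)) (hmem _ hk) i j
    have e2 := hI (a k) (hmem _ hk.le) i j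
    have e3 := intervalIntegral.integral_add_adjacent_intervals
      (ha0 ▸ hsub (hint i j) 0 (Nat.zero_le _) k hk.le) (hsub (hint i j) k hk.le (k + 1) hk)
    have e4 : ((β (circlePt ((k + 1 : ℕ) / N)) : Mat3) - (β (circlePt ((k : ℕ) / N)) : Mat3)) i j
        = ∫ s in (a k)..(a (k + 1)), g s i j := by
      rw [Matrix.sub_apply]
      change (β ((a (k + 1) : ℝ) : AddCircle (2 * Real.pi)) : Mat3) i j -
        (β ((a k : ℝ) : AddCircle (2 * Real.pi)) : Mat3) i j = _
      rw [e1, e2, ← e3]; ring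
    rw [e4, ← hstep k]
    refine sq_intervalIntegral_le (hamono k.le_succ) ((hL i j).mono_measure ?_)
    exact Measure.restrict_mono
      (Set.Ioc_subset_Ioc (hmem k hk.le).1 (hmem (k + 1) hk).2) le_rfl
  have tot : ∀ i j, ∑ k ∈ Finset.range N,
      ((β (circlePt ((k + 1 : ℕ) / N)) : Mat3) - (β (circlePt ((k : ℕ) / N)) : Mat3)) i j ^ 2 ≤
        2 * Real.pi / N * ∫ s in (0 : ℝ)..(2 * Real.pi), g s i j ^ 2 := by
    intro i j
    have e := intervalIntegral.sum_integral_adjacent_intervals (n := N)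
      (f := fun s => g s i j ^ 2) (a := a)
      fun k hk => hsub (hint2 i j) k hk.le (k + 1) hk
    rw [ha0, haN] at e
    rw [← e, Finset.mul_sum]
    exact Finset.sum_le_sum fun k hk => key k (Finset.mem_range.1 hk) i j
  have hd : dirichlet g = 1 / 2 * ∑ i, ∑ j, ∫ s in (0 : ℝ)..(2 * Real.pi), g s i j ^ 2 := by
    unfold dirichlet
    rw [intervalIntegral.integral_finsetSum]
    · congr 1
      refine Finset.sum_congr rfl fun i _ => ?_
      exact intervalIntegral.integral_finsetSum fun j _ => hint2 i j
    · intro i _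
      have := IntervalIntegrable.sum Finset.univ fun j _ => hint2 i j
      rwa [Finset.sum_fn] at this
  have hsum : ∑ k ∈ Finset.range N, frobSq ((β (circlePt ((k + 1 : ℕ) / N)) : Mat3) -
      (β (circlePt ((k : ℕ) / N)) : Mat3)) ≤
      2 * Real.pi / N * ∑ i, ∑ j, ∫ s in (0 : ℝ)..(2 * Real.pi), g s i j ^ 2 := by
    simp only [frobSq]
    rw [Finset.sum_comm, Finset.mul_sum]
    refine Finset.sum_le_sum fun i _ => ?_
    rw [Finset.sum_comm, Finset.mul_sum]
    exact Finset.sum_le_sum fun j _ => tot i j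
  rw [hd]
  calc _ ≤ (N : ℝ) * (2 * Real.pi / N *
      ∑ i, ∑ j, ∫ s in (0 : ℝ)..(2 * Real.pi), g s i j ^ 2) := by gcongr
    _ = _ := by field_simp; ring

/-! ### Chords and arcs on unit spheres -/

section Sphere

variable {E : Type*} [NormedAddCommGroup E] [InnerProductSpace ℝ E]

/-- For nearby unit vectors the chord is almost as long as the arc. -/
theorem angle_sq_le_of_norm_sub_le {ε : ℝ} {u v : E} (hu : ‖u‖ = 1) (hv : ‖v‖ = 1)
    (huv : ‖u - v‖ ^ 2 ≤ 3 * ε) :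
    (1 - ε) * InnerProductGeometry.angle u v ^ 2 ≤ ‖u - v‖ ^ 2 := by
  set α := InnerProductGeometry.angle u v with hα
  have h1 : ‖u - v‖ ^ 2 = 4 * Real.sin (α / 2) ^ 2 := by
    rw [norm_sub_sq_real, hu, hv, InnerProductGeometry.inner_eq_cos_angle_of_norm_eq_one hu hv,
      ← hα, Real.sin_sq_eq_half_sub]
    ring_nf
  have hα0 : 0 ≤ α := InnerProductGeometry.angle_nonneg u v
  have hαpi : α ≤ Real.pi := InnerProductGeometry.angle_le_pi u v
  set x := α / 2 with hx
  have hαx : α = 2 * x := by rw [hx]; ring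
  rw [h1] at huv ⊢
  rw [hαx]
  have hx0 : 0 ≤ x := by positivity
  rcases hx0.eq_or_lt with h0 | hpos
  · simp [← h0]
  -- Jordan's inequality turns the bound on the chord into `x² ≤ 3ε`; then `sin x > x - x³/6` gives
  -- `sin² x ≥ x²(1 - x²/3) ≥ (1 - ε)x²`.
  have hJ : 2 / Real.pi * x ≤ Real.sin x := Real.mul_le_sin hx0 (by linarith)
  have hJ' : x ≤ 2 * Real.sin x := by
    have : 1 / 2 ≤ 2 / Real.pi := by
      rw [div_le_div_iff₀ (by norm_num) Real.pi_pos]; linarith [Real.pi_le_four]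
    nlinarith
  have hc := Real.sin_gt_sub_cube hpos
  have hx3 : x ^ 2 ≤ 3 * ε := by nlinarith
  by_cases h6 : x ^ 2 ≤ 6
  · have hs : 0 ≤ x - x ^ 3 / 6 := by nlinarith
    have : (x - x ^ 3 / 6) ^ 2 ≤ Real.sin x ^ 2 := by gcongr
    nlinarith [sq_nonneg (x ^ 3)]
  -- Here `6 < x² ≤ 3ε`, so `1 - ε` is negative.
  · nlinarith [sq_nonneg (Real.sin x), sq_nonneg x]

theorem angle_le_sum_angle (v : ℕ → E) {N : ℕ} (hN : 0 < N) :
    InnerProductGeometry.angle (v 0) (v N) ≤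
      ∑ k ∈ Finset.range N, InnerProductGeometry.angle (v k) (v (k + 1)) := by
  induction N, hN using Nat.le_induction with
  | base => simp
  | succ n hn ih =>
    rw [Finset.sum_range_succ]
    exact (InnerProductGeometry.angle_le_angle_add_angle (v 0) (v n) (v (n + 1))).trans
      (by gcongr)

/-- The triangle inequality for angles becomes quadratic by Cauchy-Schwarz; the factor `1 - ε` pays
for replacing arcs by chords. -/
theorem angle_sq_le_sum_norm_sub_sq {ε : ℝ} (hε : ε ≤ 1) {v : ℕ → E} (hv : ∀ k, ‖v k‖ = 1)
    {N : ℕ} (hN : 0 < N) (hd : ∀ k < N, ‖v k - v (k + 1)‖ ^ 2 ≤ 3 * ε) :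
    (1 - ε) * InnerProductGeometry.angle (v 0) (v N) ^ 2 ≤
      N * ∑ k ∈ Finset.range N, ‖v k - v (k + 1)‖ ^ 2 := by
  have h1 := angle_le_sum_angle v hN
  have h2 := sq_sum_le_card_mul_sum_sq (s := Finset.range N)
    (f := fun k => InnerProductGeometry.angle (v k) (v (k + 1)))
  rw [Finset.card_range] at h2
  have h3 : InnerProductGeometry.angle (v 0) (v N) ^ 2 ≤
      (∑ k ∈ Finset.range N, InnerProductGeometry.angle (v k) (v (k + 1))) ^ 2 :=
    pow_le_pow_left₀ (InnerProductGeometry.angle_nonneg _ _) h1 2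
  calc _ ≤ (1 - ε) * (N * ∑ k ∈ Finset.range N,
        InnerProductGeometry.angle (v k) (v (k + 1)) ^ 2) := by
        have : 0 ≤ 1 - ε := by linarith
        exact mul_le_mul_of_nonneg_left (h3.trans h2) this
    _ = N * ∑ k ∈ Finset.range N,
        (1 - ε) * InnerProductGeometry.angle (v k) (v (k + 1)) ^ 2 := by
        rw [← Finset.mul_sum]; ring
    _ ≤ _ := by
        gcongr with k hk
        exact angle_sq_le_of_norm_sub_le (hv _) (hv _) (hd k (Finset.mem_range.1 hk))

/-- A lower bound for the energy of a loop that is locally compared with a curve `V` on a unit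
sphere. -/
theorem le_dirichlet_of_forall_compare {X : Set Mat3} {β : Loop X} {g : ℝ → Mat3}
    (h : HasH1Deriv β g) {V : ℝ → E} (hVc : Continuous V) (hV : ∀ t, ‖V t‖ = 1) {C T : ℝ}
    (hC : 0 ≤ C)
    (hcmp : ∀ ε ∈ Set.Ioo (0 : ℝ) 1, ∃ η > 0, ∀ s ∈ Set.Icc (0 : ℝ) 1, ∀ t ∈ Set.Icc (0 : ℝ) 1,
      |t - s| < η → C * ((1 - ε) * (‖V s - V t‖ ^ 2 - T * (t - s) ^ 2)) ≤
        frobSq ((β (circlePt t) : Mat3) - (β (circlePt s) : Mat3))) :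
    C * (InnerProductGeometry.angle (V 0) (V 1) ^ 2 - T) ≤ 4 * Real.pi * dirichlet g := by
  -- One factor `1 - ε` is the loss in `hcmp`, the other that of passing from arcs to chords; both
  -- disappear as `ε → 0`.
  have main : ∀ ε ∈ Set.Ioo (0 : ℝ) 1,
      C * ((1 - ε) * ((1 - ε) * InnerProductGeometry.angle (V 0) (V 1) ^ 2 - T)) ≤
        4 * Real.pi * dirichlet g := by
    intro ε hε
    obtain ⟨η, hη, hcmp⟩ := hcmp ε hε
    have hu := isCompact_Icc.uniformContinuousOn_of_continuous (s := Set.Icc (0 : ℝ) 1)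
      hVc.continuousOn
    obtain ⟨δ, hδ, hu⟩ := Metric.uniformContinuousOn_iff.1 hu (√(3 * ε))
      (Real.sqrt_pos.2 (by linarith [hε.1]))
    obtain ⟨n, hn⟩ := exists_nat_one_div_lt (lt_min hη hδ)
    set N := n + 1 with hNdef
    have hN : 0 < N := Nat.succ_pos n
    have hN' : (0 : ℝ) < N := by exact_mod_cast hN
    have hn' : (1 : ℝ) / N < min η δ := by rw [hNdef]; push_cast; exact hn
    have hmem : ∀ k ≤ N, ((k : ℕ) / N : ℝ) ∈ Set.Icc (0 : ℝ) 1 := fun k hk =>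
      ⟨by positivity, by rw [div_le_one hN']; exact_mod_cast hk⟩
    have hstep : ∀ k : ℕ, (((k + 1 : ℕ) : ℝ) / N - (k : ℝ) / N) = 1 / N := fun k => by
      push_cast; ring
    have h1 := sum_frobSq_le h hN
    have h2 := angle_sq_le_sum_norm_sub_sq hε.2.le (v := fun k : ℕ => V ((k : ℝ) / N))
      (fun k => hV _) hN (fun k hk => by
        have := hu _ (hmem k hk.le) _ (hmem (k + 1) hk) (by
          rw [dist_comm, Real.dist_eq, hstep k, abs_of_pos (by positivity)]
          exact hn'.trans_le (min_le_right _ _))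
        rw [dist_eq_norm] at this
        calc _ ≤ √(3 * ε) ^ 2 := by gcongr
          _ = 3 * ε := Real.sq_sqrt (by linarith [hε.1]))
    simp only [Nat.cast_zero, zero_div, div_self hN'.ne'] at h2
    have h3 : ∀ k ∈ Finset.range N,
        C * ((1 - ε) * (‖V ((k : ℝ) / N) - V (((k + 1 : ℕ) : ℝ) / N)‖ ^ 2 - T * (1 / N) ^ 2)) ≤
        frobSq ((β (circlePt ((k + 1 : ℕ) / N)) : Mat3) - (β (circlePt ((k : ℕ) / N)) : Mat3)) := by
      intro k hk
      have hk := Finset.mem_range.1 hk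
      have := hcmp _ (hmem k hk.le) _ (hmem (k + 1) hk) (by
        rw [hstep k, abs_of_pos (by positivity)]
        exact hn'.trans_le (min_le_left _ _))
      rwa [hstep k] at this
    refine le_trans ?_ h1
    calc _ ≤ C * ((1 - ε) * (N * ∑ k ∈ Finset.range N,
          ‖V ((k : ℝ) / N) - V (((k + 1 : ℕ) : ℝ) / N)‖ ^ 2 - T)) := by
          gcongr
          linarith [hε.2]
      -- The `N` steps have length `1/N`, so the terms `T (1/N)²` add up to `T/N`, and the factor
      -- `N` restores `T`.
      _ = N * ∑ k ∈ Finset.range N, C * ((1 - ε) *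
          (‖V ((k : ℝ) / N) - V (((k + 1 : ℕ) : ℝ) / N)‖ ^ 2 - T * (1 / N) ^ 2)) := by
          rw [← Finset.mul_sum, ← Finset.mul_sum, Finset.sum_sub_distrib, Finset.sum_const,
            Finset.card_range, nsmul_eq_mul]
          field_simp
      _ ≤ _ := by gcongr with k hk; exact h3 k hk
  have hlim : Filter.Tendsto (fun ε : ℝ =>
      C * ((1 - ε) * ((1 - ε) * InnerProductGeometry.angle (V 0) (V 1) ^ 2 - T)))
      (nhdsWithin 0 (Set.Ioi 0))
      (nhds (C * ((1 - 0) * ((1 - 0) * InnerProductGeometry.angle (V 0) (V 1) ^ 2 - T)))) := by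
    refine Filter.Tendsto.mono_left (Continuous.tendsto ?_ 0) nhdsWithin_le_nhds
    fun_prop
  have := le_of_tendsto hlim
    (Filter.eventually_of_mem (Ioo_mem_nhdsGT (zero_lt_one' ℝ)) main)
  simpa using this

end Sphere

/-! ### Free homotopies, lifts and monodromy -/

section Topology

variable {X : Type*} [TopologicalSpace X]

theorem toLoop_circlePt {x : X} (γ : Path x x) (t : I) : toLoop γ (circlePt t) = γ t := by
  have h := toLoop_apply γ (θ := 2 * Real.pi * t)
    ⟨by have := t.2.1; positivity, by nlinarith [Real.two_pi_pos, t.2.2]⟩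
  rw [circlePt, h, mul_div_cancel_left₀ _ Real.two_pi_pos.ne', Path.extend_apply _ t.2]

theorem exists_eq_circlePt (q : AddCircle (2 * Real.pi)) : ∃ t : I, q = circlePt t := by
  obtain ⟨θ, hθ, rfl⟩ := AddCircle.eq_coe_Ico q
  have := Real.two_pi_pos
  refine ⟨⟨θ / (2 * Real.pi), div_nonneg hθ.1 this.le, (div_le_one this).2 hθ.2.le⟩, ?_⟩
  simp only [circlePt]
  rw [mul_div_cancel₀ _ this.ne']

/-- A map from the square that agrees on two opposite sides is a homotopy of loops. -/
theorem homotopic_of_square (Φ : C(I × I, X)) (hΦ : ∀ s, Φ (s, 0) = Φ (s, 1)) {β β' : Loop X}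
    (h0 : ∀ t : I, Φ (0, t) = β (circlePt t)) (h1 : ∀ t : I, Φ (1, t) = β' (circlePt t)) :
    β.Homotopic β' := by
  -- Since opposite sides agree, the square is a closed path in the space of maps `I → X`; `toLoop`
  -- then supplies continuity on the circle.
  let G : C(I, C(I, X)) := (Φ.comp ContinuousMap.prodSwap).curry
  let g : Path (G 0) (G 0) :=
    { toFun := G
      continuous_toFun := G.continuous
      source' := rfl
      target' := by ext s; exact (hΦ s).symm }
  have key : ∀ s t : I, toLoop g (circlePt t) s = Φ (s, t) := fun s t => by
    rw [toLoop_circlePt g t]; rfl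
  refine ⟨⟨⟨fun z => toLoop g z.2 z.1, ?_⟩, fun q => ?_, fun q => ?_⟩⟩
  · exact continuous_eval.comp
      (((toLoop g).continuous.comp continuous_snd).prodMk continuous_fst)
  · obtain ⟨t, rfl⟩ := exists_eq_circlePt q
    exact (key 0 t).trans (h0 t)
  · obtain ⟨t, rfl⟩ := exists_eq_circlePt q
    exact (key 1 t).trans (h1 t)

theorem freeClass_eq_iff {β β' : Loop X} : freeClass β = freeClass β' ↔ β.Homotopic β' :=
  Quotient.eq (r := freeSetoid X)

variable {E : Type*} [TopologicalSpace E] {G : Type*} [Group G] [MulAction G E]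

/-- Some lift of the loop `β` along `f : E → X` ends at the translate by `g` of its start. -/
def HasMonodromy (f : E → X) (β : Loop X) (g : G) : Prop :=
  ∃ q : C(I, E), (∀ t : I, f (q t) = β (circlePt t)) ∧ q 1 = g • q 0

variable {f : E → X} (hf : IsQuotientCoveringMap f G)
include hf

/-- The monodromy along a loop is determined up to conjugation by its free homotopy class. -/
theorem isConj_of_hasMonodromy {β β' : Loop X} (h : β.Homotopic β') {g g' : G}
    (hg : HasMonodromy f β g) (hg' : HasMonodromy f β' g') : IsConj g g' := by
  obtain ⟨q, hq, hq1⟩ := hg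
  obtain ⟨q', hq', hq1'⟩ := hg'
  obtain ⟨F⟩ := h
  have cov := hf.isCoveringMap
  have hsmul := hf.toContinuousConstSMul
  have hcancel := hf.isCancelSMul
  let c : C(I, AddCircle (2 * Real.pi)) :=
    ⟨fun t => circlePt t, continuous_circlePt.comp continuous_subtype_val⟩
  let H : C(I × I, X) := F.toContinuousMap.comp ((ContinuousMap.id I).prodMap c)
  have H0 : ∀ a, H (0, a) = f (q a) := fun a => by
    rw [hq a]; exact F.apply_zero _
  let L := cov.liftHomotopy H q H0
  have hL : ∀ s t, f (L (s, t)) = F (s, circlePt t) := fun s t =>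
    congrFun (cov.liftHomotopy_lifts H q H0) (s, t)
  have hL0 : ∀ t, L (0, t) = q t := cov.liftHomotopy_zero H q H0
  -- Both sides lift the path of base points of the homotopy and agree at `s = 0`: the monodromy
  -- stays `g` throughout.
  have e1 : (fun s => L (s, 1)) = fun s => g • L (s, 0) := by
    refine cov.eq_of_comp_eq (by fun_prop) (by fun_prop) ?_ 0 ?_
    · ext s
      simp only [Function.comp_apply, hf.map_smul, hL]
      simp [circlePt_one]
    · simp only [hL0, hq1]
  -- The lift at `s = 1` may start at another point of the fibre than `q'`; this translation is the
  -- conjugating element.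
  obtain ⟨c, hc⟩ : ∃ c : G, c • L (1, 0) = q' 0 := by
    refine MulAction.mem_orbit_iff.1 (hf.apply_eq_iff_mem_orbit.1 ?_)
    rw [hL, hq']; exact (F.apply_one _).symm
  have e2 : (fun t => c • L (1, t)) = q' := by
    refine cov.eq_of_comp_eq (by fun_prop) q'.continuous ?_ 0 hc
    ext t
    simp only [Function.comp_apply, hf.map_smul, hL, hq']
    exact F.apply_one _
  have e3 : c * g = g' * c := by
    refine IsCancelSMul.right_cancel _ _ (L (1, 0)) ?_
    rw [mul_smul, mul_smul, ← congrFun e1 1, hc, ← hq1', congrFun e2 1]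
  exact isConj_iff.2 ⟨c, by rw [e3]; simp⟩

theorem exists_hasMonodromy (β : Loop X) : ∃ g : G, HasMonodromy f β g := by
  obtain ⟨e, he⟩ := hf.surjective (β (circlePt 0))
  let γ : C(I, X) := ⟨fun t => β (circlePt t),
    β.continuous.comp (continuous_circlePt.comp continuous_subtype_val)⟩
  obtain ⟨q, hq, hq0⟩ := hf.isCoveringMap.exists_path_lifts γ e (by simp [γ, he])
  obtain ⟨g, hg⟩ : ∃ g : G, g • q 0 = q 1 := by
    refine MulAction.mem_orbit_iff.1 (hf.apply_eq_iff_mem_orbit.1 ?_)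
    rw [← Function.comp_apply (f := f), hq, ← Function.comp_apply (f := f), hq]
    simp [γ, circlePt_one]
  exact ⟨g, q, fun t => congrFun hq t, hg.symm⟩

/-- For lifts starting at one fixed point of the fibre the monodromy is a homomorphism on `π₁`,
which is what controls products of loops. -/
theorem hasMonodromy_toLoop {x : X} (e : f ⁻¹' {x}) (γ : Path x x) :
    HasMonodromy f (toLoop γ)
      (hf.fundamentalGroupToMulOpposite e (FundamentalGroup.fromPath ⟦γ⟧)).unop := by
  have he : γ 0 = f e := γ.source.trans e.2.symm
  refine ⟨hf.isCoveringMap.liftPath γ e he, fun t => ?_, ?_⟩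
  · rw [toLoop_circlePt]
    exact congrFun (hf.isCoveringMap.liftPath_lifts γ e he) t
  · rw [hf.isCoveringMap.liftPath_zero, hf.unop_fundamentalGroupToMulOpposite_smul]
    rfl

end Topology

/-! ### Bounds for decomposed energies -/

/-- A conjugation invariant subadditive function of the monodromy that bounds the energy from
below also bounds the decomposed energy. -/
theorem le_decomposedEnergy {X : Set Mat3} {E : Type*} [TopologicalSpace E] {G : Type*} [Group G]
    [MulAction G E] {f : E → X} (hf : IsQuotientCoveringMap f G) {w : G → ℝ≥0∞} (w1 : w 1 = 0)
    (wmul : ∀ g h, w (g * h) ≤ w g + w h) (wconj : ∀ g h, IsConj g h → w g = w h)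
    (hw : ∀ (β : Loop X) (g : G), HasMonodromy f β g → w g ≤ energy (freeClass β))
    (x₀ : X) {β : Loop X} {g : G} (hg : HasMonodromy f β g) :
    w g ≤ decomposedEnergy x₀ (freeClass β) := by
  obtain ⟨e, he⟩ := hf.surjective x₀
  set φ := hf.fundamentalGroupToMulOpposite (x := x₀) ⟨e, he⟩ with hφ
  have h1 : ∀ a : FundamentalGroup X x₀, w (φ a).unop ≤ energy (forgetBase a) := by
    intro a
    induction a using Quotient.inductionOn with | _ γ => ?_
    exact hw _ _ (hasMonodromy_toLoop hf ⟨e, he⟩ γ)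
  have h2 : ∀ l : List (FundamentalGroup X x₀),
      w (φ l.prod).unop ≤ (l.map fun a => energy (forgetBase a)).sum := by
    intro l
    induction l with
    | nil => rw [List.prod_nil, map_one, MulOpposite.unop_one, w1]; exact zero_le
    | cons a l ih =>
      -- The homomorphism lands in the opposite group, so the factors are swapped; the sum of
      -- energies does not depend on the order.
      rw [List.prod_cons, map_mul, MulOpposite.unop_mul, List.map_cons, List.sum_cons, add_comm]
      exact (wmul _ _).trans (add_le_add ih (h1 a))
  refine le_iInf fun l => le_iInf fun _ => le_iInf fun hl => ?_
  refine le_trans (le_of_eq ?_) (h2 l)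
  generalize l.prod = a at hl
  induction a using Quotient.inductionOn with | _ γ => ?_
  exact wconj _ _ (isConj_of_hasMonodromy hf (freeClass_eq_iff.1 hl.symm) hg
    (hasMonodromy_toLoop hf ⟨e, he⟩ γ))

theorem decomposedEnergy_le_energy {X : Set Mat3} {x₀ : X} (γ : Path x₀ x₀) :
    decomposedEnergy x₀ (freeClass (toLoop γ)) ≤ energy (freeClass (toLoop γ)) := by
  let a : FundamentalGroup X x₀ := FundamentalGroup.fromPath ⟦γ⟧
  refine (iInf_le_of_le [a] (iInf_le_of_le (List.cons_ne_nil _ _) (iInf_le_of_le ?_ le_rfl))).trans ?_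
  · simp only [List.prod_singleton]; rfl
  · simp only [List.map_cons, List.map_nil, List.sum_singleton]; exact le_rfl

theorem decomposedEnergy_trans_le {X : Set Mat3} {x₀ : X} (γ γ' : Path x₀ x₀) :
    decomposedEnergy x₀ (freeClass (toLoop (γ.trans γ'))) ≤
      energy (freeClass (toLoop γ)) + energy (freeClass (toLoop γ')) := by
  let a : FundamentalGroup X x₀ := FundamentalGroup.fromPath ⟦γ⟧
  let b : FundamentalGroup X x₀ := FundamentalGroup.fromPath ⟦γ'⟧
  -- The product of `FundamentalGroup` concatenates in the opposite order, so `b * a` is the class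
  -- of `γ.trans γ'`.
  refine (iInf_le_of_le [b, a] (iInf_le_of_le (List.cons_ne_nil _ _) (iInf_le_of_le ?_ le_rfl))).trans ?_
  · simp only [List.prod_cons, List.prod_nil, mul_one]; rfl
  · simp only [List.map_cons, List.map_nil, List.sum_cons, List.sum_nil, add_zero]
    rw [add_comm]; exact le_rfl

/-! ### Rotations -/

/-- The group of unit quaternions. -/
abbrev UnitQuat : Type := Metric.sphere (0 : ℍ) 1

/-- The matrix of `v ↦ q v q*` on the imaginary quaternions. -/
def rot (q : ℍ) : Mat3 :=
  !![q.re ^ 2 + q.imI ^ 2 - q.imJ ^ 2 - q.imK ^ 2, 2 * (q.imI * q.imJ - q.re * q.imK),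
      2 * (q.imI * q.imK + q.re * q.imJ);
    2 * (q.imI * q.imJ + q.re * q.imK), q.re ^ 2 - q.imI ^ 2 + q.imJ ^ 2 - q.imK ^ 2,
      2 * (q.imJ * q.imK - q.re * q.imI);
    2 * (q.imI * q.imK - q.re * q.imJ), 2 * (q.imJ * q.imK + q.re * q.imI),
      q.re ^ 2 - q.imI ^ 2 - q.imJ ^ 2 + q.imK ^ 2]

theorem rot_mul (p q : ℍ) : rot (p * q) = rot p * rot q := by
  ext i j
  fin_cases i <;> fin_cases j <;>
    simp [rot, Matrix.mul_apply, Fin.sum_univ_three] <;> ring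

theorem rot_one : rot 1 = 1 := by
  ext i j
  fin_cases i <;> fin_cases j <;> simp [rot]

theorem rot_star (q : ℍ) : rot (star q) = (rot q)ᵀ := by
  ext i j
  fin_cases i <;> fin_cases j <;> simp [rot] <;> ring

theorem continuous_rot : Continuous rot := by
  refine continuous_matrix fun i j => ?_
  have := Quaternion.continuous_re
  have := Quaternion.continuous_imI
  have := Quaternion.continuous_imJ
  have := Quaternion.continuous_imK
  fin_cases i <;> fin_cases j <;> simp [rot] <;> fun_prop

theorem UnitQuat.mul_star (q : UnitQuat) : (q : ℍ) * star (q : ℍ) = 1 := by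
  rw [Quaternion.self_mul_star, Quaternion.normSq_eq_norm_mul_self, norm_eq_of_mem_sphere]
  simp

theorem UnitQuat.coe_inv (q : UnitQuat) : ((q⁻¹ : UnitQuat) : ℍ) = star (q : ℍ) := by
  rw [Metric.unitSphere.coe_inv]
  exact inv_eq_of_mul_eq_one_right q.mul_star

theorem UnitQuat.sq_add_sq (q : UnitQuat) :
    (q : ℍ).re ^ 2 + (q : ℍ).imI ^ 2 + (q : ℍ).imJ ^ 2 + (q : ℍ).imK ^ 2 = 1 := by
  rw [← Quaternion.normSq_def', Quaternion.normSq_eq_norm_mul_self, norm_eq_of_mem_sphere]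
  simp

/-- The quaternion with given components. -/
def quat (a b c d : ℝ) : ℍ := ⟨a, b, c, d⟩

@[simp] theorem quat_re (a b c d : ℝ) : (quat a b c d).re = a := rfl

@[simp] theorem quat_imI (a b c d : ℝ) : (quat a b c d).imI = b := rfl

@[simp] theorem quat_imJ (a b c d : ℝ) : (quat a b c d).imJ = c := rfl

@[simp] theorem quat_imK (a b c d : ℝ) : (quat a b c d).imK = d := rfl

theorem norm_eq_one_of_sq_add_sq {q : ℍ}
    (h : q.re ^ 2 + q.imI ^ 2 + q.imJ ^ 2 + q.imK ^ 2 = 1) : ‖q‖ = 1 := by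
  rw [← Quaternion.normSq_def', Quaternion.normSq_eq_norm_mul_self] at h
  nlinarith [norm_nonneg q]

/-- The unit quaternion with given components. -/
def mkUnitQuat (a b c d : ℝ) (h : a ^ 2 + b ^ 2 + c ^ 2 + d ^ 2 = 1) : UnitQuat :=
  ⟨quat a b c d, mem_sphere_zero_iff_norm.2 (norm_eq_one_of_sq_add_sq h)⟩

@[simp] theorem coe_mkUnitQuat (a b c d : ℝ) (h : a ^ 2 + b ^ 2 + c ^ 2 + d ^ 2 = 1) :
    (mkUnitQuat a b c d h : ℍ) = quat a b c d := rfl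

theorem rot_mul_transpose (q : UnitQuat) : rot q * (rot q)ᵀ = 1 := by
  rw [← rot_star, ← rot_mul, q.mul_star, rot_one]

theorem transpose_mul_rot (q : UnitQuat) : (rot q)ᵀ * rot q = 1 :=
  mul_eq_one_comm.1 (rot_mul_transpose q)

/-- Conjugation of a matrix by the rotation of a unit quaternion. -/
def conjBy (q : UnitQuat) (M : Mat3) : Mat3 := (rot q)ᵀ * M * rot q

theorem conjBy_mul (p q : UnitQuat) (M : Mat3) : conjBy (p * q) M = conjBy q (conjBy p M) := by
  simp only [conjBy, Metric.unitSphere.coe_mul, rot_mul, transpose_mul, Matrix.mul_assoc]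

theorem conjBy_one (M : Mat3) : conjBy 1 M = M := by
  simp [conjBy, rot_one]

theorem conjBy_sub (q : UnitQuat) (M M' : Mat3) : conjBy q (M - M') = conjBy q M - conjBy q M' := by
  simp only [conjBy, Matrix.mul_sub, Matrix.sub_mul]

theorem conjBy_smul (q : UnitQuat) (r : ℝ) (M : Mat3) : conjBy q (r • M) = r • conjBy q M := by
  simp only [conjBy, Matrix.mul_smul, Matrix.smul_mul]

theorem conjBy_vecMulVec (q : UnitQuat) (u v : Fin 3 → ℝ) :
    conjBy q (vecMulVec u v) = vecMulVec (u ᵥ* rot q) (v ᵥ* rot q) := by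
  rw [conjBy, Matrix.mul_vecMulVec, Matrix.vecMulVec_mul, Matrix.mulVec_transpose]

theorem dotProduct_vecMul_rot (q : UnitQuat) (u v : Fin 3 → ℝ) :
    (u ᵥ* rot q) ⬝ᵥ (v ᵥ* rot q) = u ⬝ᵥ v := by
  rw [← Matrix.mulVec_transpose (rot q) v, Matrix.dotProduct_mulVec, Matrix.vecMul_vecMul,
    rot_mul_transpose, Matrix.vecMul_one]

theorem continuous_conjBy : Continuous fun z : UnitQuat × Mat3 => conjBy z.1 z.2 := by
  have h : Continuous fun z : UnitQuat × Mat3 => rot z.1 :=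
    continuous_rot.comp (continuous_subtype_val.comp continuous_fst)
  exact (h.matrix_transpose.matrix_mul continuous_snd).matrix_mul h

theorem frobSq_eq_trace (M : Mat3) : frobSq M = (M * Mᵀ).trace := by
  simp [frobSq, Matrix.trace, Matrix.mul_apply, sq]

theorem frobSq_conjBy (q : UnitQuat) (M : Mat3) : frobSq (conjBy q M) = frobSq M := by
  rw [frobSq_eq_trace, frobSq_eq_trace]
  have : conjBy q M * (conjBy q M)ᵀ = (rot q)ᵀ * (M * (rot q * (rot q)ᵀ) * Mᵀ * rot q) := by
    simp only [conjBy, transpose_mul, transpose_transpose, Matrix.mul_assoc]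
  rw [this, rot_mul_transpose, Matrix.trace_mul_comm, Matrix.mul_one]
  simp only [Matrix.mul_assoc, rot_mul_transpose, Matrix.mul_one]

theorem frobSq_smul (r : ℝ) (M : Mat3) : frobSq (r • M) = r ^ 2 * frobSq M := by
  simp [frobSq, Finset.mul_sum, mul_pow]

theorem conjBy_mem_mfdP {r : ℝ} (q : UnitQuat) {Q : Mat3} (hQ : Q ∈ mfdP r) :
    conjBy q Q ∈ mfdP r := by
  obtain ⟨n, hn, rfl⟩ := hQ
  exact ⟨n ᵥ* rot q, by rw [dotProduct_vecMul_rot, hn], by rw [conjBy_smul, conjBy_vecMulVec]⟩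

theorem conjBy_mem_mfdN {r : ℝ} (q : UnitQuat) {Q : Mat3} (hQ : Q ∈ mfdN r) :
    conjBy q Q ∈ mfdN r := by
  obtain ⟨n, m, hn, hm, hnm, rfl⟩ := hQ
  exact ⟨n ᵥ* rot q, m ᵥ* rot q, by rw [dotProduct_vecMul_rot, hn],
    by rw [dotProduct_vecMul_rot, hm], by rw [dotProduct_vecMul_rot, hnm],
    by rw [conjBy_smul, conjBy_sub, conjBy_vecMulVec, conjBy_vecMulVec]⟩

theorem exists_vecMul_rot_eq {n : Fin 3 → ℝ} (hn : n ⬝ᵥ n = 1) :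
    ∃ q : UnitQuat, e1 ᵥ* rot q = n := by
  simp only [dotProduct, Fin.sum_univ_three] at hn
  -- The half-turn `j` carries `e⁽¹⁾` to its antipode. Otherwise the half-angle quaternion with axis
  -- along `(0, n₂, -n₁)`, orthogonal to `e⁽¹⁾` and `n`, does it; its components have the
  -- denominator `2a`.
  by_cases h : n 0 = -1
  · refine ⟨mkUnitQuat 0 0 1 0 (by norm_num), ?_⟩
    have h1 : n 1 = 0 := by nlinarith [sq_nonneg (n 1), sq_nonneg (n 2)]
    have h2 : n 2 = 0 := by nlinarith [sq_nonneg (n 1), sq_nonneg (n 2)]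
    ext j
    fin_cases j <;> simp [rot, e1, Matrix.vecMul, dotProduct, Fin.sum_univ_three, h,
      h1, h2]
  · have hpos : 0 < (1 + n 0) / 2 := by
      have : -1 ≤ n 0 := by nlinarith [sq_nonneg (n 1), sq_nonneg (n 2)]
      have := lt_of_le_of_ne this (Ne.symm h)
      linarith
    set a := √((1 + n 0) / 2) with ha
    have ha2 : a ^ 2 = (1 + n 0) / 2 := Real.sq_sqrt hpos.le
    have ha0 : a ≠ 0 := (Real.sqrt_pos.2 hpos).ne'
    have hcd : (n 2 / (2 * a)) ^ 2 + (-n 1 / (2 * a)) ^ 2 = (1 - n 0) / 2 := by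
      have : (n 2) ^ 2 + (n 1) ^ 2 = (1 - n 0) * (1 + n 0) := by linarith
      rw [div_pow, div_pow, ← add_div, mul_pow, ha2, neg_sq, this]
      have : 1 + n 0 ≠ 0 := by linarith
      field_simp
    refine ⟨mkUnitQuat a 0 (n 2 / (2 * a)) (-n 1 / (2 * a)) (by rw [ha2]; linarith), ?_⟩
    ext j
    fin_cases j <;> simp [rot, e1, Matrix.vecMul, dotProduct, Fin.sum_univ_three]
    · rw [ha2]; linarith
    · field_simp
    · field_simp

/-- Once `e⁽¹⁾` goes to `n`, rotations about `e⁽¹⁾` remain free, and they carry `e⁽²⁾` to any unit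
vector orthogonal to `e⁽¹⁾`. -/
theorem exists_vecMul_rot_eq_pair {n m : Fin 3 → ℝ} (hn : n ⬝ᵥ n = 1) (hm : m ⬝ᵥ m = 1)
    (hnm : n ⬝ᵥ m = 0) : ∃ q : UnitQuat, e1 ᵥ* rot q = n ∧ e2 ᵥ* rot q = m := by
  obtain ⟨q, hq⟩ := exists_vecMul_rot_eq hn
  set m' := m ᵥ* rot (q⁻¹ : UnitQuat) with hm'
  have hinv : rot (q⁻¹ : UnitQuat) * rot q = 1 := by
    rw [UnitQuat.coe_inv, rot_star, transpose_mul_rot]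
  have hm'q : m' ᵥ* rot q = m := by rw [hm', Matrix.vecMul_vecMul, hinv, Matrix.vecMul_one]
  have h0 : e1 ⬝ᵥ m' = 0 := by rw [← dotProduct_vecMul_rot q, hq, hm'q, hnm]
  have h1 : m' ⬝ᵥ m' = 1 := by rw [hm', dotProduct_vecMul_rot, hm]
  have h00 : m' 0 = 0 := by simpa [e1, dotProduct, Fin.sum_univ_three] using h0
  simp only [dotProduct, Fin.sum_univ_three, h00] at h1
  set z : ℂ := ⟨m' 1, m' 2⟩ with hz
  have hz1 : ‖z‖ = 1 := by
    rw [Complex.norm_eq_sqrt_sq_add_sq, hz]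
    simp only
    rw [show m' 1 ^ 2 + m' 2 ^ 2 = 1 by linarith, Real.sqrt_one]
  set φ := z.arg with hφ
  have hc : Real.cos φ = m' 1 := by
    rw [hφ, Complex.cos_arg (by intro h; simp [h] at hz1), hz1]; simp [hz]
  have hs : Real.sin φ = m' 2 := by rw [hφ, Complex.sin_arg, hz1]; simp [hz]
  set p := mkUnitQuat (Real.cos (φ / 2)) (-Real.sin (φ / 2)) 0 0
    (by have := Real.sin_sq_add_cos_sq (φ / 2); linarith) with hp
  have hcs := Real.sin_sq_add_cos_sq (φ / 2)
  have hc2 : Real.cos φ = Real.cos (φ / 2) ^ 2 - Real.sin (φ / 2) ^ 2 := by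
    rw [← Real.cos_two_mul']; ring_nf
  have hs2 : Real.sin φ = 2 * Real.sin (φ / 2) * Real.cos (φ / 2) := by
    rw [← Real.sin_two_mul]; ring_nf
  have hp1 : e1 ᵥ* rot p = e1 := by
    ext j
    fin_cases j <;> simp [hp, rot, e1, Matrix.vecMul, dotProduct, Fin.sum_univ_three]
  have hp2 : e2 ᵥ* rot p = m' := by
    ext j
    fin_cases j <;> simp [hp, rot, e2, Matrix.vecMul, dotProduct, Fin.sum_univ_three,
      h00]
    · rw [← hc, hc2]
    · rw [← hs, hs2]; ring
  refine ⟨p * q, ?_, ?_⟩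
  · rw [Metric.unitSphere.coe_mul, rot_mul, ← Matrix.vecMul_vecMul, hp1, hq]
  · rw [Metric.unitSphere.coe_mul, rot_mul, ← Matrix.vecMul_vecMul, hp2, hm'q]

theorem exists_conjBy_eq_of_mem_mfdP {r : ℝ} {Q : Mat3} (hQ : Q ∈ mfdP r) :
    ∃ q : UnitQuat, conjBy q (baseP r) = Q := by
  obtain ⟨n, hn, rfl⟩ := hQ
  obtain ⟨q, hq⟩ := exists_vecMul_rot_eq hn
  exact ⟨q, by rw [baseP, conjBy_smul, conjBy_vecMulVec, hq]⟩

theorem exists_conjBy_eq_of_mem_mfdN {r : ℝ} {Q : Mat3} (hQ : Q ∈ mfdN r) :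
    ∃ q : UnitQuat, conjBy q (baseN r) = Q := by
  obtain ⟨n, m, hn, hm, hnm, rfl⟩ := hQ
  obtain ⟨q, hq, hq'⟩ := exists_vecMul_rot_eq_pair hn hm hnm
  exact ⟨q, by rw [baseN, conjBy_smul, conjBy_sub, conjBy_vecMulVec, conjBy_vecMulVec, hq, hq']⟩

/-! ### Change of the base point by rotations -/

theorem one_lt_rank_quaternion : 1 < Module.rank ℝ ℍ := by
  rw [Quaternion.rank_eq_four]
  norm_num

instance : PathConnectedSpace UnitQuat :=
  isPathConnected_iff_pathConnectedSpace.1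
    (isPathConnected_sphere one_lt_rank_quaternion 0 zero_le_one)

section BaseChange

variable {X : Set Mat3} (hX : ∀ (q : UnitQuat) {Q : Mat3}, Q ∈ X → conjBy q Q ∈ X)

/-- The rotation action on a rotation invariant set of matrices. -/
def conjMap : C(UnitQuat × X, X) where
  toFun z := ⟨conjBy z.1 z.2, hX z.1 z.2.2⟩
  continuous_toFun := Continuous.subtype_mk
    (continuous_conjBy.comp (continuous_fst.prodMk (continuous_subtype_val.comp continuous_snd))) _

/-- A rotated loop, based at the rotated base point. -/
def rotPath {x y : X} (q : UnitQuat) (hq : conjMap hX (q, x) = y) (γ : Path x x) : Path y y :=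
  (γ.map (f := fun Q => conjMap hX (q, Q)) (by fun_prop)).cast hq.symm hq.symm

theorem rotPath_apply {x y : X} (q : UnitQuat) (hq : conjMap hX (q, x) = y) (γ : Path x x)
    (t : I) : rotPath hX q hq γ t = conjMap hX (q, γ t) := rfl

/-- The unit quaternions are path connected, so `q` can be deformed to `1`; the base point moves
along, which a free homotopy allows. This transports loops to an arbitrary base point. -/
theorem freeClass_rotPath {x y : X} (q : UnitQuat) (hq : conjMap hX (q, x) = y) (γ : Path x x) :
    freeClass (toLoop (rotPath hX q hq γ)) = freeClass (toLoop γ) := by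
  let δ : Path q 1 := PathConnectedSpace.somePath q 1
  refine freeClass_eq_iff.2 (homotopic_of_square
    ((conjMap hX).comp (δ.toContinuousMap.prodMap γ.toContinuousMap)) (fun s => ?_)
    (fun t => ?_) fun t => ?_)
  · simp
  · simp [toLoop_circlePt, rotPath_apply]
  · rw [toLoop_circlePt]
    refine Subtype.ext ?_
    simp [conjMap, conjBy_one]

theorem rotPath_trans {x y : X} (q : UnitQuat) (hq : conjMap hX (q, x) = y) (γ γ' : Path x x) :
    rotPath hX q hq (γ.trans γ') = (rotPath hX q hq γ).trans (rotPath hX q hq γ') := by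
  ext t
  rw [rotPath_apply, Path.trans_apply, Path.trans_apply]
  split_ifs <;> rfl

end BaseChange

/-! ### The covering of `𝒩` by the unit quaternions -/

/-- The stabilizer of `e⁽¹⁾⊗e⁽¹⁾ - e⁽²⁾⊗e⁽²⁾`, which consists of `±1, ±i, ±j, ±k`. -/
def quatStabilizer : Subgroup UnitQuat where
  carrier := {g | conjBy g (baseN 1) = baseN 1}
  mul_mem' {g h} hg hh := by
    rw [Set.mem_ofPred_eq] at *
    rw [conjBy_mul, hg, hh]
  one_mem' := conjBy_one _
  inv_mem' {g} hg := by
    rw [Set.mem_ofPred_eq] at *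
    nth_rw 1 [← hg]
    rw [← conjBy_mul, mul_inv_cancel, conjBy_one]

theorem baseN_eq_smul (r : ℝ) : (baseN r : Mat3) = r • (baseN 1 : Mat3) := by
  simp [baseN]

theorem mem_quatStabilizer {g : UnitQuat} :
    g ∈ quatStabilizer ↔ conjBy g (baseN 1) = baseN 1 := Iff.rfl

theorem conjBy_baseN_apply (q : UnitQuat) (i j : Fin 3) :
    conjBy q (baseN 1) i j = rot q 0 i * rot q 0 j - rot q 1 i * rot q 1 j := by
  have h1 : e1 ᵥ* rot q = rot q 0 := by
    ext j; simp [e1, Matrix.vecMul, dotProduct, Fin.sum_univ_three]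
  have h2 : e2 ᵥ* rot q = rot q 1 := by
    ext j; simp [e2, Matrix.vecMul, dotProduct, Fin.sum_univ_three]
  simp only [baseN, one_smul, conjBy_sub, conjBy_vecMulVec, h1, h2, Matrix.sub_apply,
    vecMulVec_apply]

/-- The first two diagonal entries and `|g| = 1` suffice: they force `(a² + b²)(c² + d²)` and `(a² +
c²)(b² + d²)` to vanish, so at most one component is nonzero. -/
theorem eq_of_mem_quatStabilizer {g : UnitQuat} (hg : g ∈ quatStabilizer) :
    (g : ℍ) = quat 1 0 0 0 ∨ (g : ℍ) = quat (-1) 0 0 0 ∨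
    (g : ℍ) = quat 0 1 0 0 ∨ (g : ℍ) = quat 0 (-1) 0 0 ∨
    (g : ℍ) = quat 0 0 1 0 ∨ (g : ℍ) = quat 0 0 (-1) 0 ∨
    (g : ℍ) = quat 0 0 0 1 ∨ (g : ℍ) = quat 0 0 0 (-1) := by
  have hn := g.sq_add_sq
  rw [mem_quatStabilizer] at hg
  have h00 : (rot g 0 0) ^ 2 - (rot g 1 0) ^ 2 = 1 := by
    rw [sq, sq, ← conjBy_baseN_apply, hg]; simp [baseN, e1, e2]
  have h11 : (rot g 0 1) ^ 2 - (rot g 1 1) ^ 2 = -1 := by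
    rw [sq, sq, ← conjBy_baseN_apply, hg]; simp [baseN, e1, e2]
  generalize (g : ℍ) = q at *
  simp [rot] at hn h00 h11
  simp only [Quaternion.ext_iff, quat_re, quat_imI, quat_imJ, quat_imK]
  generalize q.re = a at *
  generalize q.imI = b at *
  generalize q.imJ = c at *
  generalize q.imK = d at *
  have p0 : 4 * (a ^ 2 + b ^ 2) * (c ^ 2 + d ^ 2) ≤ 0 := by
    have : 4 * (a ^ 2 + b ^ 2) * (c ^ 2 + d ^ 2) =
      (a ^ 2 + b ^ 2 + c ^ 2 + d ^ 2) ^ 2 - (a ^ 2 + b ^ 2 - c ^ 2 - d ^ 2) ^ 2 := by ring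
    rw [this, hn]; nlinarith [sq_nonneg (2 * (b * c + a * d))]
  have p1 : 4 * (a ^ 2 + c ^ 2) * (b ^ 2 + d ^ 2) ≤ 0 := by
    have : 4 * (a ^ 2 + c ^ 2) * (b ^ 2 + d ^ 2) =
      (a ^ 2 + b ^ 2 + c ^ 2 + d ^ 2) ^ 2 - (a ^ 2 - b ^ 2 + c ^ 2 - d ^ 2) ^ 2 := by ring
    rw [this, hn]; nlinarith [sq_nonneg (2 * (b * c - a * d))]
  have hac : a * c = 0 := by
    nlinarith [sq_nonneg (a * c), sq_nonneg (a * d), sq_nonneg (b * c), sq_nonneg (b * d)]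
  have had : a * d = 0 := by
    nlinarith [sq_nonneg (a * c), sq_nonneg (a * d), sq_nonneg (b * c), sq_nonneg (b * d)]
  have hbc : b * c = 0 := by
    nlinarith [sq_nonneg (a * c), sq_nonneg (a * d), sq_nonneg (b * c), sq_nonneg (b * d)]
  have hbd : b * d = 0 := by
    nlinarith [sq_nonneg (a * c), sq_nonneg (a * d), sq_nonneg (b * c), sq_nonneg (b * d)]
  have hab : a * b = 0 := by
    nlinarith [sq_nonneg (a * b), sq_nonneg (a * d), sq_nonneg (c * b), sq_nonneg (c * d)]
  have hcd : c * d = 0 := by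
    nlinarith [sq_nonneg (a * b), sq_nonneg (a * d), sq_nonneg (c * b), sq_nonneg (c * d)]
  by_cases ha : a = 0
  · by_cases hb : b = 0
    · by_cases hc : c = 0
      · have : d = 1 ∨ d = -1 := sq_eq_one_iff.1 <| by simpa [ha, hb, hc] using hn
        rcases this with rfl | rfl <;> simp [ha, hb, hc]
      · have hd : d = 0 := by simpa [hc] using hcd
        have : c = 1 ∨ c = -1 := sq_eq_one_iff.1 <| by simpa [ha, hb, hd] using hn
        rcases this with rfl | rfl <;> simp [ha, hb, hd]
    · have hc : c = 0 := by simpa [hb] using hbc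
      have hd : d = 0 := by simpa [hb] using hbd
      have : b = 1 ∨ b = -1 := sq_eq_one_iff.1 <| by simpa [ha, hc, hd] using hn
      rcases this with rfl | rfl <;> simp [ha, hc, hd]
  · have hb : b = 0 := by simpa [ha] using hab
    have hc : c = 0 := by simpa [ha] using hac
    have hd : d = 0 := by simpa [ha] using had
    have : a = 1 ∨ a = -1 := sq_eq_one_iff.1 <| by simpa [hb, hc, hd] using hn
    rcases this with rfl | rfl <;> simp [hb, hc, hd]

theorem finite_quatStabilizer : (quatStabilizer : Set UnitQuat).Finite := by
  refine Set.Finite.of_finite_image (f := Subtype.val) ?_ Subtype.val_injective.injOn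
  refine Set.Finite.subset (s := {quat 1 0 0 0, quat (-1) 0 0 0, quat 0 1 0 0, quat 0 (-1) 0 0,
    quat 0 0 1 0, quat 0 0 (-1) 0, quat 0 0 0 1, quat 0 0 0 (-1)}) (Set.toFinite _) ?_
  rintro _ ⟨g, hg, rfl⟩
  simpa only [Set.mem_insert_iff, Set.mem_singleton_iff] using eq_of_mem_quatStabilizer hg

/-- The covering map from the unit quaternions to `𝒩`. -/
def covN (r : ℝ) (q : UnitQuat) : mfdN r := conjMap conjBy_mem_mfdN (q, baseN r)

theorem coe_covN (r : ℝ) (q : UnitQuat) : (covN r q : Mat3) = r • conjBy q (baseN 1) := by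
  rw [← conjBy_smul, ← baseN_eq_smul]; rfl

theorem continuous_covN (r : ℝ) : Continuous (covN r) := by
  unfold covN; fun_prop

/-- A continuous surjection from a compact space to a Hausdorff space is a quotient map, and the
fibres are the orbits of a finite subgroup under left multiplication. -/
theorem isQuotientCoveringMap_covN {r : ℝ} (hr : 0 < r) :
    IsQuotientCoveringMap (covN r) quatStabilizer := by
  have hs : Function.Surjective (covN r) := fun Q => by
    obtain ⟨q, hq⟩ := exists_conjBy_eq_of_mem_mfdN Q.2
    exact ⟨q, Subtype.ext hq⟩
  refine ((continuous_covN r).isClosedMap.isQuotientMap (continuous_covN r)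
    hs).isQuotientCoveringMap_of_subgroup quatStabilizer finite_quatStabilizer.isDiscrete
    fun {q q'} => ?_
  rw [mem_quatStabilizer, Subtype.ext_iff, coe_covN, coe_covN, (smul_right_injective _ hr.ne').eq_iff,
    conjBy_mul]
  constructor
  · intro h
    rw [← h, ← conjBy_mul, mul_inv_cancel, conjBy_one]
  · intro h
    nth_rw 1 [← h]
    rw [← conjBy_mul, inv_mul_cancel, conjBy_one]

/-! ### Lower bounds for the energy of loops in `𝒩` -/

/-- To second order at `h = 1` this is `8r²(b² + c² + 4d²)`: a rotation about the third axis turns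
`n` and `m` into each other and costs four times as much. -/
theorem frobSq_covN_one (r : ℝ) (h : UnitQuat) :
    frobSq (r • conjBy h (baseN 1) - r • (baseN 1 : Mat3)) =
      r ^ 2 * (8 * ((h : ℍ).imI ^ 2 + (h : ℍ).imJ ^ 2) * ((h : ℍ).re ^ 2 + (h : ℍ).imK ^ 2) +
      32 * ((h : ℍ).imI ^ 2 * (h : ℍ).imJ ^ 2 + (h : ℍ).re ^ 2 * (h : ℍ).imK ^ 2)) := by
  rw [← smul_sub, frobSq_smul]
  congr 1
  have hn := h.sq_add_sq
  -- Factors `|h|⁴ = 1`, inserted here and on the right, make both sides homogeneous of degree 8,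
  -- and the identity becomes polynomial.
  have e : ∀ i j, (conjBy h (baseN 1) - (baseN 1 : Mat3)) i j =
      rot h 0 i * rot h 0 j - rot h 1 i * rot h 1 j -
      ((h : ℍ).re ^ 2 + (h : ℍ).imI ^ 2 + (h : ℍ).imJ ^ 2 + (h : ℍ).imK ^ 2) ^ 2 *
        (baseN 1 : Mat3) i j := fun i j => by
    rw [hn, Matrix.sub_apply, conjBy_baseN_apply]; ring
  simp only [frobSq, e]
  generalize (h : ℍ) = q at *
  obtain ⟨a, b, c, d⟩ := q
  simp only at hn
  have : (8 * (b ^ 2 + c ^ 2) * (a ^ 2 + d ^ 2) + 32 * (b ^ 2 * c ^ 2 + a ^ 2 * d ^ 2)) =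
    (a ^ 2 + b ^ 2 + c ^ 2 + d ^ 2) ^ 2 *
    (8 * (b ^ 2 + c ^ 2) * (a ^ 2 + d ^ 2) + 32 * (b ^ 2 * c ^ 2 + a ^ 2 * d ^ 2)) := by
    rw [hn]; ring
  rw [this]
  simp [Fin.sum_univ_three, baseN, e1, e2, rot]
  ring

theorem frobSq_covN_sub (r : ℝ) (p q : UnitQuat) :
    frobSq ((covN r q : Mat3) - (covN r p : Mat3)) =
      frobSq (r • conjBy (q * p⁻¹) (baseN 1) - r • (baseN 1 : Mat3)) := by
  rw [← frobSq_conjBy p (r • _ - _), conjBy_sub, conjBy_smul, conjBy_smul, ← conjBy_mul, inv_mul_cancel_right,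
    coe_covN, coe_covN]

/-- The discrete form of `(d + τ)² ≤ 4d² + 4τ²/3`, with `δ` the increment of the twisting angle and
`a`, `d` the real and `k` components of the increment of the lift. The constant `4/3` is `1` from
`cos δ` plus `1/3` from `2d sin δ ≤ 3d² + (sin² δ)/3`. -/
theorem chord_sub_le {ε a d δ : ℝ} (hε : ε ∈ Set.Ioo (0 : ℝ) 1) (ha : 1 - ε / 4 ≤ a)
    (ha1 : a ≤ 1) :
    (1 - ε) * (2 - 2 * (a * Real.cos δ - d * Real.sin δ) - 4 / 3 * δ ^ 2) ≤
      a ^ 2 * (1 - a ^ 2 + 3 * d ^ 2) := by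
  obtain ⟨hε0, hε1⟩ := hε
  have hsin : Real.sin δ ^ 2 ≤ δ ^ 2 := by
    have h := Real.one_sub_sq_div_two_le_cos (x := 2 * δ)
    have h2 := Real.sin_sq_eq_half_sub δ
    nlinarith
  have hcos := Real.one_sub_sq_div_two_le_cos (x := δ)
  have hd : 2 * (d * Real.sin δ) ≤ 3 * d ^ 2 + δ ^ 2 / 3 := by
    nlinarith [sq_nonneg (3 * d - Real.sin δ)]
  have hc : -(2 * (a * Real.cos δ)) ≤ -(2 * a) + δ ^ 2 := by
    nlinarith [sq_nonneg δ]
  have h1 : 2 - 2 * (a * Real.cos δ - d * Real.sin δ) - 4 / 3 * δ ^ 2 ≤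
      2 * (1 - a) + 3 * d ^ 2 := by linarith
  have ha2 : 1 - ε / 2 ≤ a ^ 2 := by nlinarith
  have h2 : (1 - ε) * 2 ≤ a ^ 2 * (1 + a) := by nlinarith
  calc _ ≤ (1 - ε) * (2 * (1 - a) + 3 * d ^ 2) :=
        mul_le_mul_of_nonneg_left h1 (by linarith)
    _ = ((1 - ε) * 2) * (1 - a) + (1 - ε) * (3 * d ^ 2) := by ring
    _ ≤ (a ^ 2 * (1 + a)) * (1 - a) + a ^ 2 * (3 * d ^ 2) := by
        have : 1 - ε ≤ a ^ 2 := by linarith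
        have : 0 ≤ 1 - a := by linarith
        gcongr
    _ = _ := by ring

theorem re_mul_star_eq {p q : ℍ} (hp : ‖p‖ = 1) (hq : ‖q‖ = 1) :
    (q * star p).re = 1 - ‖p - q‖ ^ 2 / 2 := by
  rw [norm_sub_sq_real, hp, hq, real_inner_comm, Quaternion.inner_def]
  ring

/-- The energy of a loop in `𝒩` is bounded below in terms of the end points of a lift, twisted by
the rotation of angle `τ`. -/
theorem le_dirichlet_of_lift {r : ℝ} {β : Loop (mfdN r)} {g : ℝ → Mat3} (h : HasH1Deriv β g)
    {q : C(I, UnitQuat)} (hq : ∀ t : I, covN r (q t) = β (circlePt t)) (τ : ℝ) :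
    8 * r ^ 2 * (InnerProductGeometry.angle (q 0 : ℍ)
      (quat (Real.cos τ) 0 0 (Real.sin τ) * (q 1 : ℍ)) ^ 2 - 4 / 3 * τ ^ 2) ≤
      4 * Real.pi * dirichlet g := by
  set p : ℝ → UnitQuat := fun t => q (Set.projIcc 0 1 zero_le_one t) with hp
  have hpc : Continuous p := q.continuous.comp continuous_projIcc
  -- Left multiplication by `exp(τtk)` adds `τ` to the `k` component of the velocity and merely
  -- rotates the `i` and `j` components.
  set V : ℝ → ℍ := fun t => quat (Real.cos (τ * t)) 0 0 (Real.sin (τ * t)) * (p t : ℍ) with hV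
  have hquat : ∀ t, quat (Real.cos (τ * t)) 0 0 (Real.sin (τ * t)) =
      Real.cos (τ * t) • (1 : ℍ) + Real.sin (τ * t) • quat 0 0 0 1 := fun t => by
    ext <;> simp
  have hVc : Continuous V := by
    simp only [hV, hquat]
    have : Continuous fun t => (p t : ℍ) := continuous_subtype_val.comp hpc
    fun_prop
  have hV1 : ∀ t, ‖V t‖ = 1 := fun t => by
    simp only [hV]
    rw [norm_mul, norm_eq_of_mem_sphere (p t), mul_one]
    refine norm_eq_one_of_sq_add_sq ?_
    simp
  have := le_dirichlet_of_forall_compare h hVc hV1 (C := 8 * r ^ 2) (T := 4 / 3 * τ ^ 2)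
    (by positivity) ?_
  · have h0 : p 0 = q 0 := by simp [hp]
    have h1 : p 1 = q 1 := by simp [hp]
    have e0 : V 0 = (q 0 : ℍ) := by
      simp only [hV, h0]
      ext <;> simp
    have e1 : V 1 = quat (Real.cos τ) 0 0 (Real.sin τ) * (q 1 : ℍ) := by
      simp only [hV, h1, mul_one]
    rwa [e0, e1] at this
  intro ε hε
  have hu := isCompact_Icc.uniformContinuousOn_of_continuous (s := Set.Icc (0 : ℝ) 1)
    (f := fun t => (p t : ℍ)) (continuous_subtype_val.comp hpc).continuousOn
  obtain ⟨η, hη, hu⟩ := Metric.uniformContinuousOn_iff.1 hu (ε / 2) (by linarith [hε.1])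
  refine ⟨η, hη, fun s hs t ht hst => ?_⟩
  have hclose := hu s hs t ht (by rwa [dist_comm, Real.dist_eq])
  rw [dist_eq_norm] at hclose
  have hβ : ∀ t ∈ Set.Icc (0 : ℝ) 1, β (circlePt t) = covN r (p t) := fun t ht => by
    simp only [hp, Set.projIcc_of_mem zero_le_one ht]
    exact (hq ⟨t, ht⟩).symm
  rw [hβ s hs, hβ t ht, frobSq_covN_sub, frobSq_covN_one]
  have hn := (p t * (p s)⁻¹).sq_add_sq
  have hre := re_mul_star_eq (norm_eq_of_mem_sphere (p s)) (norm_eq_of_mem_sphere (p t))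
  have hVV : ‖V s - V t‖ ^ 2 = 2 - 2 * (((p t : ℍ) * star (p s : ℍ)).re * Real.cos (τ * (t - s)) -
      ((p t : ℍ) * star (p s : ℍ)).imK * Real.sin (τ * (t - s))) := by
    rw [norm_sub_sq_real, hV1, hV1, mul_sub τ, Real.cos_sub, Real.sin_sub, Quaternion.inner_def]
    simp only [hV]
    simp
    ring
  rw [Metric.unitSphere.coe_mul, UnitQuat.coe_inv] at hn ⊢
  rw [hVV]
  set z : ℍ := (p t : ℍ) * star (p s : ℍ) with hz
  have ha1 : z.re ≤ 1 := by rw [hre]; nlinarith [sq_nonneg ‖(p s : ℍ) - (p t : ℍ)‖]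
  have ha : 1 - ε / 4 ≤ z.re := by
    rw [hre]
    nlinarith [norm_nonneg ((p s : ℍ) - (p t : ℍ)), hε.1, hε.2]
  have hcore := chord_sub_le (d := z.imK) (δ := τ * (t - s)) hε ha ha1
  calc _ = 8 * r ^ 2 * ((1 - ε) * (2 - 2 * (z.re * Real.cos (τ * (t - s)) -
        z.imK * Real.sin (τ * (t - s))) - 4 / 3 * (τ * (t - s)) ^ 2)) := by ring
    _ ≤ 8 * r ^ 2 * (z.re ^ 2 * (1 - z.re ^ 2 + 3 * z.imK ^ 2)) := by gcongr
    -- The added terms are nonnegative and of fourth order near `1`; they complete the exact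
    -- expression of `frobSq_covN_one`.
    _ ≤ 8 * r ^ 2 * (z.re ^ 2 * (1 - z.re ^ 2 + 3 * z.imK ^ 2) +
        (z.imI ^ 2 + z.imJ ^ 2) * z.imK ^ 2 + 4 * (z.imI ^ 2 * z.imJ ^ 2)) := by
        gcongr
        have : 0 ≤ (z.imI ^ 2 + z.imJ ^ 2) * z.imK ^ 2 + 4 * (z.imI ^ 2 * z.imJ ^ 2) := by
          positivity
        linarith
    _ = _ := by
        have : 1 - z.re ^ 2 = z.imI ^ 2 + z.imJ ^ 2 + z.imK ^ 2 := by linarith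
        rw [this]; ring

/-- The minimal energies of the free homotopy classes in `𝒩`, in units of `πr²/2`, as a function
of the monodromy `±1, ±i, ±j, ±k`; for `±k` it is only a lower bound. -/
def weight (q : ℍ) : ℝ := 2 * (q.re ^ 2 - q.re) + q.imI ^ 2 + q.imJ ^ 2 + 8 / 3 * q.imK ^ 2

/-- The minimal decomposed energies of the free homotopy classes in `𝒩`, in units of `πr²/2`, as
a function of the monodromy `±1, ±i, ±j, ±k`. -/
def starWeight (q : ℍ) : ℝ := q.imI ^ 2 + q.imJ ^ 2 + 2 * q.imK ^ 2 + (q.re ^ 2 - q.re)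

/-- A twist with `exp(τk) g = -1` makes the end points antipodal: `τ = 0` for `-1` and `τ = ±π/2`
for `±k`. For `±i, ±j` no twist is used, and `g q` is orthogonal to `q`. -/
theorem weight_mul_le_dirichlet {r : ℝ} {β : Loop (mfdN r)} {γ : ℝ → Mat3} (h : HasH1Deriv β γ)
    {g : quatStabilizer} (hg : HasMonodromy (covN r) β g) :
    Real.pi * r ^ 2 / 2 * weight (g : UnitQuat) ≤ dirichlet γ := by
  obtain ⟨q, hq, hq1⟩ := hg
  have hpi := Real.pi_pos
  have hq1' : (q 1 : ℍ) = ((g : UnitQuat) : ℍ) * (q 0 : ℍ) := by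
    rw [hq1]; rfl
  have key : ∀ τ ψ : ℝ, InnerProductGeometry.angle (q 0 : ℍ)
      (quat (Real.cos τ) 0 0 (Real.sin τ) * (q 1 : ℍ)) = ψ →
      8 * r ^ 2 * (ψ ^ 2 - 4 / 3 * τ ^ 2) ≤ 4 * Real.pi * dirichlet γ := fun τ ψ hψ => by
    rw [← hψ]; exact le_dirichlet_of_lift h hq τ
  have hq0 : (q 0 : ℍ) ≠ 0 := fun h0 => by
    have := norm_eq_of_mem_sphere (q 0)
    simp [h0] at this
  have hneg : ∀ τ, quat (Real.cos τ) 0 0 (Real.sin τ) * ((g : UnitQuat) : ℍ) = -1 →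
      8 * r ^ 2 * (Real.pi ^ 2 - 4 / 3 * τ ^ 2) ≤ 4 * Real.pi * dirichlet γ := fun τ hτ => by
    refine key τ _ ?_
    rw [hq1', ← mul_assoc, hτ, neg_one_mul]
    exact InnerProductGeometry.angle_self_neg_of_nonzero hq0
  have hort : ((g : UnitQuat) : ℍ).re = 0 →
      8 * r ^ 2 * ((Real.pi / 2) ^ 2 - 4 / 3 * 0 ^ 2) ≤ 4 * Real.pi * dirichlet γ := fun h0 => by
    refine key 0 _ (InnerProductGeometry.inner_eq_zero_iff_angle_eq_pi_div_two _ _ |>.1 ?_)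
    have e : quat (Real.cos 0) 0 0 (Real.sin 0) = 1 := by ext <;> simp
    rw [e, one_mul, hq1', real_inner_comm, Quaternion.inner_def, mul_assoc, UnitQuat.mul_star,
      mul_one, h0]
  have fin : ∀ c : ℝ, 8 * r ^ 2 * (Real.pi ^ 2 / 4 * c) ≤ 4 * Real.pi * dirichlet γ →
      Real.pi * r ^ 2 / 2 * c ≤ dirichlet γ := fun c hc => by
    refine le_of_mul_le_mul_left ?_ (show 0 < 4 * Real.pi by positivity)
    refine le_trans (le_of_eq ?_) hc
    ring
  have hd0 : 0 ≤ dirichlet γ := by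
    unfold dirichlet
    have : 0 ≤ ∫ s in (0 : ℝ)..(2 * Real.pi), ∑ i, ∑ j, (γ s i j) ^ 2 :=
      intervalIntegral.integral_nonneg Real.two_pi_pos.le fun s _ => by positivity
    positivity
  refine fin _ ?_
  rcases eq_of_mem_quatStabilizer g.2 with e | e | e | e | e | e | e | e <;>
    rw [e] at hneg hort <;> rw [e] <;> simp only [weight, quat_re, quat_imI, quat_imJ, quat_imK]
  · norm_num; positivity
  · refine le_trans (le_of_eq ?_) (hneg 0 (by ext <;> simp))
    ring
  iterate 4
    refine le_trans (le_of_eq ?_) (hort rfl)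
    ring
  · refine le_trans (le_of_eq ?_) (hneg (Real.pi / 2) (by ext <;> simp))
    ring
  · refine le_trans (le_of_eq ?_) (hneg (-(Real.pi / 2)) (by ext <;> simp))
    ring

/-- On this group `starWeight` is the word length for the generators `±i, ±j`. -/
theorem starWeight_mul_le {p q : UnitQuat} (hp : p ∈ quatStabilizer) (hq : q ∈ quatStabilizer) :
    starWeight (p * q : UnitQuat) ≤ starWeight p + starWeight q := by
  rw [Metric.unitSphere.coe_mul]
  rcases eq_of_mem_quatStabilizer hp with e | e | e | e | e | e | e | e <;>
  rcases eq_of_mem_quatStabilizer hq with e' | e' | e' | e' | e' | e' | e' | e' <;>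
  rw [e, e'] <;> simp [starWeight] <;> norm_num

theorem starWeight_nonneg {g : UnitQuat} (hg : g ∈ quatStabilizer) : 0 ≤ starWeight g := by
  rcases eq_of_mem_quatStabilizer hg with e | e | e | e | e | e | e | e <;>
  rw [e] <;> simp [starWeight]

theorem starWeight_le_weight {g : UnitQuat} (hg : g ∈ quatStabilizer) :
    starWeight g ≤ weight g := by
  rcases eq_of_mem_quatStabilizer hg with e | e | e | e | e | e | e | e <;>
  rw [e] <;> simp [starWeight, weight] <;> norm_num

/-- Conjugation within the group at most changes the sign of an imaginary unit. Hence `weight` and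
`starWeight` are class functions. -/
theorem sq_eq_of_isConj {g h : quatStabilizer} (hgh : IsConj g h) :
    ((g : UnitQuat) : ℍ).re = ((h : UnitQuat) : ℍ).re ∧
    ((g : UnitQuat) : ℍ).imI ^ 2 = ((h : UnitQuat) : ℍ).imI ^ 2 ∧
    ((g : UnitQuat) : ℍ).imJ ^ 2 = ((h : UnitQuat) : ℍ).imJ ^ 2 ∧
    ((g : UnitQuat) : ℍ).imK ^ 2 = ((h : UnitQuat) : ℍ).imK ^ 2 := by
  obtain ⟨c, hc⟩ := isConj_iff.1 hgh
  have : ((h : UnitQuat) : ℍ) = ((c : UnitQuat) : ℍ) * ((g : UnitQuat) : ℍ) *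
      star ((c : UnitQuat) : ℍ) := by
    rw [← hc, ← UnitQuat.coe_inv]; rfl
  rw [this]
  rcases eq_of_mem_quatStabilizer c.2 with e | e | e | e | e | e | e | e <;>
  rw [e] <;> simp

/-- The lower bound for the energy of a free homotopy class in `𝒩`. -/
theorem weight_mul_le_energy {r : ℝ} (hr : 0 < r) {β : Loop (mfdN r)} {g : quatStabilizer}
    (hg : HasMonodromy (covN r) β g) :
    ENNReal.ofReal (Real.pi * r ^ 2 / 2 * weight (g : UnitQuat)) ≤ energy (freeClass β) := by
  refine le_iInf fun β' => le_iInf fun γ => le_iInf fun hβ' => le_iInf fun hγ => ?_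
  refine ENNReal.ofReal_le_ofReal ?_
  have hf := isQuotientCoveringMap_covN hr
  obtain ⟨g', hg'⟩ := exists_hasMonodromy hf β'
  have hc := sq_eq_of_isConj (isConj_of_hasMonodromy hf (freeClass_eq_iff.1 hβ') hg' hg)
  have e : weight (g : UnitQuat) = weight (g' : UnitQuat) := by
    simp only [weight, hc]
  rw [e]
  exact weight_mul_le_dirichlet hγ hg'

/-- The lower bound for the decomposed energy of a free homotopy class in `𝒩`. -/
theorem starWeight_mul_le_decomposedEnergy {r : ℝ} (hr : 0 < r) (x₀ : mfdN r)
    {β : Loop (mfdN r)} {g : quatStabilizer} (hg : HasMonodromy (covN r) β g) :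
    ENNReal.ofReal (Real.pi * r ^ 2 / 2 * starWeight (g : UnitQuat)) ≤
      decomposedEnergy x₀ (freeClass β) := by
  have hK : 0 ≤ Real.pi * r ^ 2 / 2 := by have := Real.pi_pos; positivity
  refine le_decomposedEnergy (isQuotientCoveringMap_covN hr)
    (w := fun g => ENNReal.ofReal (Real.pi * r ^ 2 / 2 * starWeight (g : UnitQuat)))
    ?_ ?_ ?_ ?_ x₀ hg
  · simp [starWeight]
  · intro g h
    rw [← ENNReal.ofReal_add (mul_nonneg hK (starWeight_nonneg g.2))
      (mul_nonneg hK (starWeight_nonneg h.2)), ← mul_add]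
    exact ENNReal.ofReal_le_ofReal
      (mul_le_mul_of_nonneg_left (starWeight_mul_le g.2 h.2) hK)
  · intro g h hgh
    have hc := sq_eq_of_isConj hgh
    simp only [starWeight, hc]
  · intro β g hg
    exact (ENNReal.ofReal_le_ofReal (mul_le_mul_of_nonneg_left (starWeight_le_weight g.2) hK)).trans
      (weight_mul_le_energy hr hg)

/-! ### The covering of `𝒫` by the sphere -/

/-- The sphere `𝕊²`. -/
abbrev Sphere2 : Type := Metric.sphere (0 : EuclideanSpace ℝ (Fin 3)) 1

/-- The group `{1, -1}`. -/
abbrev SignGroup : Type := Metric.sphere (0 : ℝ) 1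

theorem eq_one_or_of_signGroup (g : SignGroup) : (g : ℝ) = 1 ∨ (g : ℝ) = -1 := by
  have := norm_eq_of_mem_sphere g
  rw [Real.norm_eq_abs] at this
  exact eq_or_eq_neg_of_abs_eq this

instance : Finite SignGroup :=
  Finite.of_injective (β := ({1, -1} : Set ℝ))
    (fun g => ⟨g, by simpa using eq_one_or_of_signGroup g⟩)
    fun g h hgh => Subtype.ext (congrArg (fun x : ({1, -1} : Set ℝ) => (x : ℝ)) hgh)

theorem Sphere2.dotProduct_self (n : Sphere2) : (n : EuclideanSpace ℝ (Fin 3)) ⬝ᵥ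
    (n : EuclideanSpace ℝ (Fin 3)) = 1 := by
  have h := norm_eq_of_mem_sphere n
  have h2 := EuclideanSpace.real_norm_sq_eq (n : EuclideanSpace ℝ (Fin 3))
  rw [h] at h2
  simp only [dotProduct, ← sq]
  linarith

/-- The covering map from the sphere to `𝒫`. -/
def covP (r : ℝ) (n : Sphere2) : mfdP r :=
  ⟨r • vecMulVec (n : EuclideanSpace ℝ (Fin 3)) (n : EuclideanSpace ℝ (Fin 3)),
    _, n.dotProduct_self, rfl⟩

theorem continuous_covP (r : ℝ) : Continuous (covP r) := by
  refine Continuous.subtype_mk (continuous_matrix fun i j => ?_) _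
  simp only [Matrix.smul_apply, vecMulVec_apply]
  fun_prop

/-- For close points this is nearly `2r²|m - n|²`, so `covP` multiplies lengths by `√2 r`. -/
theorem frobSq_covP_sub (r : ℝ) (m n : Sphere2) :
    frobSq ((covP r n : Mat3) - (covP r m : Mat3)) =
      2 * r ^ 2 * (1 - inner ℝ (m : EuclideanSpace ℝ (Fin 3)) n ^ 2) := by
  have hm := m.dotProduct_self
  have hn := n.dotProduct_self
  have e : inner ℝ (m : EuclideanSpace ℝ (Fin 3)) n =
      (n : EuclideanSpace ℝ (Fin 3)) ⬝ᵥ (m : EuclideanSpace ℝ (Fin 3)) := by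
    simp [PiLp.inner_apply, dotProduct]
  rw [e, covP, covP, ← smul_sub, frobSq_smul]
  have h : frobSq (vecMulVec (n : EuclideanSpace ℝ (Fin 3)) n -
      vecMulVec (m : EuclideanSpace ℝ (Fin 3)) m) = ((n : EuclideanSpace ℝ (Fin 3)) ⬝ᵥ n) ^ 2 +
      ((m : EuclideanSpace ℝ (Fin 3)) ⬝ᵥ m) ^ 2 -
      2 * ((n : EuclideanSpace ℝ (Fin 3)) ⬝ᵥ m) ^ 2 := by
    simp only [frobSq, dotProduct, Fin.sum_univ_three, Matrix.sub_apply, vecMulVec_apply]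
    ring
  rw [h, hm, hn]
  ring

theorem covP_eq_iff {r : ℝ} (hr : 0 < r) {m n : Sphere2} :
    covP r m = covP r n ↔ m ∈ MulAction.orbit SignGroup n := by
  constructor
  · intro h
    have h1 := frobSq_covP_sub r n m
    rw [h, sub_self] at h1
    have h2 : frobSq 0 = 0 := by simp [frobSq]
    rw [h2] at h1
    have h3 : inner ℝ (n : EuclideanSpace ℝ (Fin 3)) m ^ 2 = 1 := by
      have : 2 * r ^ 2 ≠ 0 := by positivity
      have := (mul_eq_zero.1 h1.symm).resolve_left this
      linarith
    rcases sq_eq_one_iff.1 h3 with h4 | h4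
    · have := (inner_eq_one_iff_of_norm_eq_one (norm_eq_of_mem_sphere n)
        (norm_eq_of_mem_sphere m)).1 h4
      exact ⟨1, (one_smul SignGroup n).trans (Subtype.ext this)⟩
    · have := (inner_eq_neg_one_iff_of_norm_eq_one (norm_eq_of_mem_sphere n)
        (norm_eq_of_mem_sphere m)).1 h4
      refine ⟨-1, Subtype.ext ?_⟩
      change (-1 : ℝ) • (n : EuclideanSpace ℝ (Fin 3)) = m
      rw [this]; simp
  · rintro ⟨g, rfl⟩
    refine Subtype.ext ?_
    ext i j
    change r * (((g : ℝ) * (n : EuclideanSpace ℝ (Fin 3)) i) *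
      ((g : ℝ) * (n : EuclideanSpace ℝ (Fin 3)) j)) =
      r * ((n : EuclideanSpace ℝ (Fin 3)) i * (n : EuclideanSpace ℝ (Fin 3)) j)
    rcases eq_one_or_of_signGroup g with h | h <;> rw [h] <;> ring

theorem isQuotientCoveringMap_covP {r : ℝ} (hr : 0 < r) :
    IsQuotientCoveringMap (covP r) SignGroup := by
  have hs : Function.Surjective (covP r) := by
    rintro ⟨_, n, hn, rfl⟩
    refine ⟨⟨WithLp.toLp 2 n, ?_⟩, rfl⟩
    rw [mem_sphere_zero_iff_norm, EuclideanSpace.norm_eq, Real.sqrt_eq_one]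
    simpa [dotProduct, sq] using hn
  have : IsCancelSMul SignGroup Sphere2 := by
    refine (isCancelSMul_iff_eq_one_of_smul_eq (α := SignGroup) (β := Sphere2)).2 fun g n h => Subtype.ext ?_
    have h' : (g : ℝ) • (n : EuclideanSpace ℝ (Fin 3)) = n := congrArg Subtype.val h
    rcases eq_one_or_of_signGroup g with e | e
    · exact e
    · rw [e, neg_one_smul, neg_eq_iff_add_eq_zero, ← two_smul ℝ, smul_eq_zero] at h'
      have := norm_eq_of_mem_sphere n
      simp [h'.resolve_left two_ne_zero] at this
  exact ((continuous_covP r).isClosedMap.isQuotientMap (continuous_covP r)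
    hs).isQuotientCoveringMap_of_properlyDiscontinuousSMul (covP_eq_iff hr)

/-- A lift joins a point to its antipode and so sweeps an angle of at least `π`; hence `2r²π²` is at
most `4π` times the energy. -/
theorem le_dirichlet_of_hasMonodromy_neg_one {r : ℝ} {β : Loop (mfdP r)} {g : ℝ → Mat3}
    (h : HasH1Deriv β g) (hβ : HasMonodromy (covP r) β (-1 : SignGroup)) :
    Real.pi * r ^ 2 / 2 ≤ dirichlet g := by
  obtain ⟨q, hq, hq1⟩ := hβ
  set p : ℝ → Sphere2 := fun t => q (Set.projIcc 0 1 zero_le_one t) with hp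
  set V : ℝ → EuclideanSpace ℝ (Fin 3) := fun t => p t with hV
  have hVc : Continuous V := continuous_subtype_val.comp (q.continuous.comp continuous_projIcc)
  have hV1 : ∀ t, ‖V t‖ = 1 := fun t => norm_eq_of_mem_sphere (p t)
  have key := le_dirichlet_of_forall_compare h hVc hV1 (C := 2 * r ^ 2) (T := 0)
    (by positivity) ?_
  · have e : V 1 = -V 0 := by
      simp only [hV, hp, Set.projIcc_left, Set.projIcc_right]
      change (q 1 : EuclideanSpace ℝ (Fin 3)) = -(q 0 : EuclideanSpace ℝ (Fin 3))
      rw [hq1]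
      change (-1 : ℝ) • (q 0 : EuclideanSpace ℝ (Fin 3)) = _
      simp
    have h0 : V 0 ≠ 0 := fun h0 => by
      have := hV1 0
      simp [h0] at this
    rw [e, InnerProductGeometry.angle_self_neg_of_nonzero h0] at key
    refine le_of_mul_le_mul_left ?_ (show 0 < 4 * Real.pi by positivity)
    refine le_trans (le_of_eq ?_) key
    ring
  intro ε hε
  have hu := isCompact_Icc.uniformContinuousOn_of_continuous (s := Set.Icc (0 : ℝ) 1)
    hVc.continuousOn
  obtain ⟨η, hη, hu⟩ := Metric.uniformContinuousOn_iff.1 hu ε hε.1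
  refine ⟨η, hη, fun s hs t ht hst => ?_⟩
  have hclose := hu s hs t ht (by rwa [dist_comm, Real.dist_eq])
  rw [dist_eq_norm] at hclose
  have hβ : ∀ t ∈ Set.Icc (0 : ℝ) 1, β (circlePt t) = covP r (p t) := fun t ht => by
    simp only [hp, Set.projIcc_of_mem zero_le_one ht]
    exact (hq ⟨t, ht⟩).symm
  rw [hβ s hs, hβ t ht, frobSq_covP_sub]
  have hin : ‖V s - V t‖ ^ 2 = 2 - 2 * inner ℝ (V s) (V t) := by
    rw [norm_sub_sq_real, hV1, hV1]; ring
  have hle : inner ℝ (V s) (V t) ≤ 1 := by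
    nlinarith [sq_nonneg ‖V s - V t‖]
  have hge : 1 - ε ≤ inner ℝ (V s) (V t) := by
    nlinarith [norm_nonneg (V s - V t), hε.1, hε.2]
  rw [hin]
  change _ ≤ 2 * r ^ 2 * (1 - inner ℝ (V s) (V t) ^ 2)
  have : (1 - ε) * (2 - 2 * inner ℝ (V s) (V t) - 0 * (t - s) ^ 2) ≤
      1 - inner ℝ (V s) (V t) ^ 2 := by nlinarith [hε.1]
  gcongr

theorem le_energy_of_hasMonodromy_neg_one {r : ℝ} (hr : 0 < r) {β : Loop (mfdP r)}
    (hβ : HasMonodromy (covP r) β (-1 : SignGroup)) :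
    ENNReal.ofReal (Real.pi * r ^ 2 / 2) ≤ energy (freeClass β) := by
  refine le_iInf fun β' => le_iInf fun γ => le_iInf fun hβ' => le_iInf fun hγ => ?_
  refine ENNReal.ofReal_le_ofReal ?_
  have hf := isQuotientCoveringMap_covP hr
  obtain ⟨g', hg'⟩ := exists_hasMonodromy hf β'
  have hc := isConj_of_hasMonodromy hf (freeClass_eq_iff.1 hβ') hg' hβ
  rw [isConj_iff_eq] at hc
  rw [hc] at hg'
  exact le_dirichlet_of_hasMonodromy_neg_one hγ hg'

/-- Every decomposition of a non-trivial loop has a non-trivial factor: the indicator of `-1` is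
subadditive. -/
theorem le_decomposedEnergy_of_hasMonodromy_neg_one {r : ℝ} (hr : 0 < r) (p₀ : mfdP r)
    {β : Loop (mfdP r)} (hβ : HasMonodromy (covP r) β (-1 : SignGroup)) :
    ENNReal.ofReal (Real.pi * r ^ 2 / 2) ≤ decomposedEnergy p₀ (freeClass β) := by
  classical
  have hdich : ∀ g : SignGroup, g = 1 ∨ g = -1 := fun g =>
    (eq_one_or_of_signGroup g).imp (fun h => Subtype.ext h) fun h => Subtype.ext h
  have hne : (-1 : SignGroup) ≠ 1 := fun h => by
    have : (-1 : ℝ) = 1 := congrArg Subtype.val h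
    norm_num at this
  have := le_decomposedEnergy (isQuotientCoveringMap_covP hr)
    (w := fun g => if g = 1 then 0 else ENNReal.ofReal (Real.pi * r ^ 2 / 2))
    ?_ ?_ ?_ ?_ p₀ hβ
  · simpa [hne] using this
  · simp
  · intro g h
    rcases hdich g with rfl | rfl
    · rw [one_mul]; exact le_add_self
    rcases hdich h with rfl | rfl
    · rw [mul_one]; exact le_self_add
    have : (-1 : SignGroup) * -1 = 1 := Subtype.ext (neg_one_mul (-1 : ℝ) |>.trans (neg_neg 1))
    rw [this, if_pos rfl]
    exact zero_le
  · intro g h hgh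
    rw [isConj_iff_eq.1 hgh]
  · intro β g hg
    rcases hdich g with rfl | rfl
    · simp
    · simpa [hne] using le_energy_of_hasMonodromy_neg_one hr hg

/-! ### Upper bounds for the energy -/

theorem energy_le_of_hasDerivAt {X : Set Mat3} {β : Loop X} {M g : ℝ → Mat3} {c : ℝ}
    (hM : ∀ θ i j, HasDerivAt (fun s => M s i j) (g θ i j) θ)
    (hg : ∀ i j, Continuous fun s => g s i j) (hc : ∀ s, frobSq (g s) = c)
    (hβ : ∀ t ∈ Set.Icc (0 : ℝ) 1, (β (circlePt t) : Mat3) = M (2 * Real.pi * t)) :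
    energy (freeClass β) ≤ ENNReal.ofReal (Real.pi * c) := by
  have h2pi := Real.two_pi_pos
  have hβ' : ∀ θ ∈ Set.Icc (0 : ℝ) (2 * Real.pi),
      (β (θ : AddCircle (2 * Real.pi)) : Mat3) = M θ := fun θ hθ => by
    have := hβ (θ / (2 * Real.pi)) ⟨div_nonneg hθ.1 h2pi.le, (div_le_one h2pi).2 hθ.2⟩
    rwa [circlePt, mul_div_cancel₀ _ h2pi.ne'] at this
  refine iInf_le_of_le β (iInf_le_of_le g (iInf_le_of_le rfl (iInf_le_of_le ⟨?_, ?_⟩ ?_)))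
  · intro i j
    obtain ⟨C, hC⟩ := isCompact_Icc.exists_bound_of_continuousOn (s := Set.Icc 0 (2 * Real.pi))
      (hg i j).continuousOn
    refine MemLp.of_bound (hg i j).aestronglyMeasurable C ?_
    exact (ae_restrict_iff' measurableSet_Ioc).2
      (Filter.Eventually.of_forall fun s hs => hC s (Set.Ioc_subset_Icc_self hs))
  · intro θ hθ i j
    rw [hβ' θ hθ, hβ' 0 ⟨le_rfl, h2pi.le⟩,
      intervalIntegral.integral_eq_sub_of_hasDerivAt (fun s _ => hM s i j)
        ((hg i j).intervalIntegrable _ _)]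
    ring
  · refine ENNReal.ofReal_le_ofReal (le_of_eq ?_)
    have : (fun s => ∑ i, ∑ j, (g s i j) ^ 2) = fun _ => c := funext hc
    rw [dirichlet, this, intervalIntegral.integral_const, smul_eq_mul]
    ring

theorem frobSq_symm_vecMulVec (u v : Fin 3 → ℝ) :
    frobSq (vecMulVec u v + vecMulVec v u) = 2 * (u ⬝ᵥ u) * (v ⬝ᵥ v) + 2 * (u ⬝ᵥ v) ^ 2 := by
  simp only [frobSq, dotProduct, Fin.sum_univ_three, Matrix.add_apply, vecMulVec_apply]
  ring

/-- The energy of a loop along which only one rank-one summand rotates. -/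
theorem energy_le_of_vecMulVec {X : Set Mat3} {β : Loop X} {a κ : ℝ} {C : Mat3}
    {n n' : ℝ → Fin 3 → ℝ} (hn : ∀ θ i, HasDerivAt (fun s => n s i) (n' θ i) θ)
    (hn' : ∀ i, Continuous fun s => n' s i) (h1 : ∀ θ, n θ ⬝ᵥ n θ = 1)
    (h0 : ∀ θ, n' θ ⬝ᵥ n θ = 0) (hκ : ∀ θ, n' θ ⬝ᵥ n' θ = κ)
    (hβ : ∀ t ∈ Set.Icc (0 : ℝ) 1, (β (circlePt t) : Mat3) =
      a • vecMulVec (n (2 * Real.pi * t)) (n (2 * Real.pi * t)) + C) :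
    energy (freeClass β) ≤ ENNReal.ofReal (2 * Real.pi * a ^ 2 * κ) := by
  have hnc : ∀ i, Continuous fun s => n s i := fun i =>
    continuous_iff_continuousAt.2 fun θ => (hn θ i).continuousAt
  refine (energy_le_of_hasDerivAt (M := fun θ => a • vecMulVec (n θ) (n θ) + C)
    (g := fun θ => a • (vecMulVec (n' θ) (n θ) + vecMulVec (n θ) (n' θ)))
    (c := a ^ 2 * (2 * κ)) ?_ ?_ ?_ hβ).trans (ENNReal.ofReal_le_ofReal (le_of_eq (by ring)))
  · intro θ i j
    exact (((hn θ i).mul (hn θ j)).const_mul a).add_const (C i j)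
  · intro i j
    simp only [Matrix.smul_apply, Matrix.add_apply, vecMulVec_apply]
    have := hnc i
    have := hnc j
    have := hn' i
    have := hn' j
    fun_prop
  · intro s
    rw [frobSq_smul, frobSq_symm_vecMulVec, h0, h1, hκ]
    ring

theorem energy_H0 (r : ℝ) : energy (H0 r) = 0 := by
  refine le_antisymm ((energy_le_of_hasDerivAt (M := fun _ => baseN r) (g := fun _ => 0) (c := 0)
    (fun θ i j => hasDerivAt_const θ _) (fun i j => continuous_const) (fun s => by simp [frobSq])
    fun t _ => rfl).trans (by simp)) zero_le

theorem hasDerivAt_cos_mul (c θ : ℝ) :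
    HasDerivAt (fun s => Real.cos (c * s)) (-(c * Real.sin (c * θ))) θ := by
  have := (Real.hasDerivAt_cos (c * θ)).comp θ ((hasDerivAt_id θ).const_mul c)
  simpa [mul_comm, Function.comp_def] using this

theorem hasDerivAt_sin_mul (c θ : ℝ) :
    HasDerivAt (fun s => Real.sin (c * s)) (c * Real.cos (c * θ)) θ := by
  have := (Real.hasDerivAt_sin (c * θ)).comp θ ((hasDerivAt_id θ).const_mul c)
  simpa [mul_comm, Function.comp_def] using this

theorem energy_h1_le (r : ℝ) : energy (h1 r) ≤ ENNReal.ofReal (Real.pi * r ^ 2 / 2) := by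
  refine (energy_le_of_vecMulVec (a := r) (C := 0) (κ := 1 / 4)
    (n := fun θ => ![Real.cos (1 / 2 * θ), Real.sin (1 / 2 * θ), 0])
    (n' := fun θ => ![-(1 / 2 * Real.sin (1 / 2 * θ)), 1 / 2 * Real.cos (1 / 2 * θ), 0])
    ?_ ?_ ?_ ?_ ?_ ?_).trans (ENNReal.ofReal_le_ofReal (le_of_eq (by ring)))
  · intro θ i
    fin_cases i
    exacts [hasDerivAt_cos_mul _ θ, hasDerivAt_sin_mul _ θ, hasDerivAt_const θ 0]
  · intro i
    fin_cases i <;> simp <;> fun_prop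
  · intro θ
    simp [dotProduct, Fin.sum_univ_three, ← sq]
  · intro θ
    simp [dotProduct, Fin.sum_univ_three]
    ring
  · intro θ
    simp [dotProduct, Fin.sum_univ_three]
    nlinarith [Real.sin_sq_add_cos_sq (2⁻¹ * θ)]
  · intro t ht
    rw [toLoop_circlePt (pathP r) ⟨t, ht⟩]
    have : 1 / 2 * (2 * Real.pi * t) = Real.pi * t := by ring
    simp only [this, add_zero]
    rfl

theorem energy_H1_le (r : ℝ) : energy (H1 r) ≤ ENNReal.ofReal (Real.pi * r ^ 2 / 2) := by
  refine (energy_le_of_vecMulVec (a := -r) (C := r • vecMulVec e1 e1) (κ := 1 / 4)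
    (n := fun θ => ![0, Real.cos (1 / 2 * θ), Real.sin (1 / 2 * θ)])
    (n' := fun θ => ![0, -(1 / 2 * Real.sin (1 / 2 * θ)), 1 / 2 * Real.cos (1 / 2 * θ)])
    ?_ ?_ ?_ ?_ ?_ ?_).trans (ENNReal.ofReal_le_ofReal (le_of_eq (by ring)))
  · intro θ i
    fin_cases i
    exacts [hasDerivAt_const θ 0, hasDerivAt_cos_mul _ θ, hasDerivAt_sin_mul _ θ]
  · intro i
    fin_cases i <;> simp <;> fun_prop
  · intro θ
    simp [dotProduct, Fin.sum_univ_three, ← sq]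
  · intro θ
    simp [dotProduct, Fin.sum_univ_three]
    ring
  · intro θ
    simp [dotProduct, Fin.sum_univ_three]
    nlinarith [Real.sin_sq_add_cos_sq (2⁻¹ * θ)]
  · intro t ht
    rw [toLoop_circlePt (pathA r) ⟨t, ht⟩]
    have : 1 / 2 * (2 * Real.pi * t) = Real.pi * t := by ring
    simp only [this, neg_smul, neg_add_eq_sub, ← smul_sub]
    rfl

theorem energy_H2_le (r : ℝ) : energy (H2 r) ≤ ENNReal.ofReal (Real.pi * r ^ 2 / 2) := by
  refine (energy_le_of_vecMulVec (a := r) (C := -(r • vecMulVec e2 e2)) (κ := 1 / 4)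
    (n := fun θ => ![Real.cos (1 / 2 * θ), 0, Real.sin (1 / 2 * θ)])
    (n' := fun θ => ![-(1 / 2 * Real.sin (1 / 2 * θ)), 0, 1 / 2 * Real.cos (1 / 2 * θ)])
    ?_ ?_ ?_ ?_ ?_ ?_).trans (ENNReal.ofReal_le_ofReal (le_of_eq (by ring)))
  · intro θ i
    fin_cases i
    exacts [hasDerivAt_cos_mul _ θ, hasDerivAt_const θ 0, hasDerivAt_sin_mul _ θ]
  · intro i
    fin_cases i <;> simp <;> fun_prop
  · intro θ
    simp [dotProduct, Fin.sum_univ_three, ← sq]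
  · intro θ
    simp [dotProduct, Fin.sum_univ_three]
    ring
  · intro θ
    simp [dotProduct, Fin.sum_univ_three]
    nlinarith [Real.sin_sq_add_cos_sq (2⁻¹ * θ)]
  · intro t ht
    rw [toLoop_circlePt (pathB r) ⟨t, ht⟩]
    have : 1 / 2 * (2 * Real.pi * t) = Real.pi * t := by ring
    simp only [this, ← sub_eq_add_neg, ← smul_sub]
    rfl

/-- The tensor `n⊗n` does not see the sign of `n`, so `A * A` is a single smooth curve along the
full great circle. -/
theorem halfCircle23_sub_one (t : ℝ) : halfCircle23 (t - 1) = -halfCircle23 t := by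
  have : Real.pi * (t - 1) = Real.pi * t - Real.pi := by ring
  ext i
  fin_cases i <;> simp [halfCircle23, this]

theorem halfCircle13_sub_one (t : ℝ) : halfCircle13 (t - 1) = -halfCircle13 t := by
  have : Real.pi * (t - 1) = Real.pi * t - Real.pi := by ring
  ext i
  fin_cases i <;> simp [halfCircle13, this]

theorem coe_pathA_trans_pathA (r : ℝ) (t : I) : ((pathA r).trans (pathA r) t : Mat3) =
    r • (vecMulVec e1 e1 - vecMulVec (halfCircle23 (2 * t)) (halfCircle23 (2 * t))) := by
  rw [Path.trans_apply]
  split_ifs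
  · rfl
  · change r • (vecMulVec e1 e1 - vecMulVec (halfCircle23 (2 * t - 1)) (halfCircle23 (2 * t - 1)))
      = _
    rw [halfCircle23_sub_one, neg_vecMulVec, vecMulVec_neg, neg_neg]

theorem energy_H4_le (r : ℝ) : energy (H4 r) ≤ ENNReal.ofReal (2 * Real.pi * r ^ 2) := by
  -- In `A * A` the vector `n` moves at unit speed, twice its speed in `A`, where `κ` is `1/4`.
  refine (energy_le_of_vecMulVec (a := -r) (C := r • vecMulVec e1 e1) (κ := 1)
    (n := fun θ => ![0, Real.cos (1 * θ), Real.sin (1 * θ)])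
    (n' := fun θ => ![0, -(1 * Real.sin (1 * θ)), 1 * Real.cos (1 * θ)])
    ?_ ?_ ?_ ?_ ?_ ?_).trans (ENNReal.ofReal_le_ofReal (le_of_eq (by ring)))
  · intro θ i
    fin_cases i
    exacts [hasDerivAt_const θ 0, hasDerivAt_cos_mul _ θ, hasDerivAt_sin_mul _ θ]
  · intro i
    fin_cases i <;> simp <;> fun_prop
  · intro θ
    simp [dotProduct, Fin.sum_univ_three, ← sq]
  · intro θ
    simp [dotProduct, Fin.sum_univ_three]
    ring
  · intro θ
    simp [dotProduct, Fin.sum_univ_three, ← sq]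
  · intro t ht
    rw [toLoop_circlePt _ ⟨t, ht⟩, coe_pathA_trans_pathA]
    have : 1 * (2 * Real.pi * t) = Real.pi * (2 * t) := by ring
    simp only [this, neg_smul, neg_add_eq_sub, ← smul_sub]
    rfl

/-! ### Lifts of the loops in `𝒩` -/

theorem coe_covN_eq_vecMulVec (r : ℝ) (q : UnitQuat) :
    (covN r q : Mat3) = r • (vecMulVec (rot q 0) (rot q 0) - vecMulVec (rot q 1) (rot q 1)) := by
  rw [coe_covN]
  congr 1
  ext i j
  rw [conjBy_baseN_apply]; rfl

theorem covN_one (r : ℝ) : covN r 1 = baseN r :=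
  Subtype.ext (conjBy_one _)

/-- For a lift that starts at `1` the end point is itself the deck transformation. -/
theorem exists_hasMonodromy_of_lift {r : ℝ} (hr : 0 < r) {γ : Path (baseN r) (baseN r)}
    (q : C(I, UnitQuat)) (h0 : q 0 = 1) (hq : ∀ t, covN r (q t) = γ t) :
    ∃ g : quatStabilizer, (g : UnitQuat) = q 1 ∧ HasMonodromy (covN r) (toLoop γ) g := by
  have h1 : q 1 ∈ quatStabilizer := by
    have := congrArg Subtype.val ((hq 1).trans (γ.target.trans (covN_one r).symm))
    rw [coe_covN, coe_covN, conjBy_one] at this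
    exact smul_right_injective _ hr.ne' this
  refine ⟨⟨q 1, h1⟩, rfl, q, fun t => by rw [hq, toLoop_circlePt], ?_⟩
  rw [h0]
  exact (mul_one (q 1)).symm

theorem rot_quat_re_imI (x : ℝ) : rot (quat (Real.cos x) (-Real.sin x) 0 0) 0 = e1 ∧
    rot (quat (Real.cos x) (-Real.sin x) 0 0) 1 = ![0, Real.cos (2 * x), Real.sin (2 * x)] := by
  rw [Real.cos_two_mul', Real.sin_two_mul]
  constructor <;> ext i <;> fin_cases i <;> simp [rot, e1]
  ring

theorem rot_quat_re_imJ (x : ℝ) :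
    rot (quat (Real.cos x) 0 (Real.sin x) 0) 0 = ![Real.cos (2 * x), 0, Real.sin (2 * x)] ∧
    rot (quat (Real.cos x) 0 (Real.sin x) 0) 1 = e2 := by
  rw [Real.cos_two_mul', Real.sin_two_mul]
  constructor <;> ext i <;> fin_cases i <;> simp [rot, e2]
  ring

theorem rot_quat_imI_imK (x : ℝ) :
    rot (quat 0 (-Real.sin x) 0 (Real.cos x)) 0 = -![Real.cos (2 * x), 0, Real.sin (2 * x)] ∧
    rot (quat 0 (-Real.sin x) 0 (Real.cos x)) 1 = -e2 := by
  rw [Real.cos_two_mul', Real.sin_two_mul]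
  constructor <;> ext i <;> fin_cases i <;> simp [rot, e2]
  · ring
  · linarith [Real.sin_sq_add_cos_sq x]

theorem continuous_mkUnitQuat {Y : Type*} [TopologicalSpace Y] {a b c d : Y → ℝ}
    (ha : Continuous a) (hb : Continuous b) (hc : Continuous c) (hd : Continuous d)
    (h : ∀ y, a y ^ 2 + b y ^ 2 + c y ^ 2 + d y ^ 2 = 1) :
    Continuous fun y => mkUnitQuat (a y) (b y) (c y) (d y) (h y) := by
  refine Continuous.subtype_mk ?_ _
  have : (fun y => quat (a y) (b y) (c y) (d y)) = fun y => a y • (1 : ℍ) +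
      b y • quat 0 1 0 0 + c y • quat 0 0 1 0 + d y • quat 0 0 0 1 := by
    ext y <;> simp
  rw [this]
  fun_prop

/-- The curve of unit quaternions with given components. -/
def unitQuatCurve (a b c d : I → ℝ) (ha : Continuous a) (hb : Continuous b) (hc : Continuous c)
    (hd : Continuous d) (h : ∀ t, a t ^ 2 + b t ^ 2 + c t ^ 2 + d t ^ 2 = 1) : C(I, UnitQuat) :=
  ⟨_, continuous_mkUnitQuat ha hb hc hd h⟩

@[simp] theorem coe_unitQuatCurve (a b c d : I → ℝ) (ha : Continuous a) (hb : Continuous b)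
    (hc : Continuous c) (hd : Continuous d)
    (h : ∀ t, a t ^ 2 + b t ^ 2 + c t ^ 2 + d t ^ 2 = 1) (t : I) :
    (unitQuatCurve a b c d ha hb hc hd h t : ℍ) = quat (a t) (b t) (c t) (d t) := rfl

theorem hasMonodromy_pathA {r : ℝ} (hr : 0 < r) : ∃ g : quatStabilizer,
    ((g : UnitQuat) : ℍ) = quat 0 (-1) 0 0 ∧ HasMonodromy (covN r) (toLoop (pathA r)) g := by
  obtain ⟨g, hg, h⟩ := exists_hasMonodromy_of_lift hr (γ := pathA r)
    (unitQuatCurve (fun t => Real.cos (Real.pi * t / 2))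
      (fun t => -Real.sin (Real.pi * t / 2)) (fun _ => 0) (fun _ => 0)
      (by fun_prop) (by fun_prop) (by fun_prop) (by fun_prop) (by simp))
    (Subtype.ext (by ext <;> simp)) fun t => Subtype.ext (by
      rw [coe_covN_eq_vecMulVec]
      simp only [coe_unitQuatCurve, rot_quat_re_imI]
      rw [mul_div_cancel₀ _ two_ne_zero]
      rfl)
  refine ⟨g, ?_, h⟩
  rw [hg]
  simp

theorem hasMonodromy_pathB {r : ℝ} (hr : 0 < r) : ∃ g : quatStabilizer,
    ((g : UnitQuat) : ℍ) = quat 0 0 1 0 ∧ HasMonodromy (covN r) (toLoop (pathB r)) g := by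
  obtain ⟨g, hg, h⟩ := exists_hasMonodromy_of_lift hr (γ := pathB r)
    (unitQuatCurve (fun t => Real.cos (Real.pi * t / 2)) (fun _ => 0)
      (fun t => Real.sin (Real.pi * t / 2)) (fun _ => 0)
      (by fun_prop) (by fun_prop) (by fun_prop) (by fun_prop) (by simp))
    (Subtype.ext (by ext <;> simp)) fun t => Subtype.ext (by
      rw [coe_covN_eq_vecMulVec]
      simp only [coe_unitQuatCurve, rot_quat_re_imJ]
      rw [mul_div_cancel₀ _ two_ne_zero]
      rfl)
  refine ⟨g, ?_, h⟩
  rw [hg]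
  simp

theorem hasMonodromy_pathA_trans_pathA {r : ℝ} (hr : 0 < r) : ∃ g : quatStabilizer,
    ((g : UnitQuat) : ℍ) = quat (-1) 0 0 0 ∧
      HasMonodromy (covN r) (toLoop ((pathA r).trans (pathA r))) g := by
  obtain ⟨g, hg, h⟩ := exists_hasMonodromy_of_lift hr (γ := (pathA r).trans (pathA r))
    (unitQuatCurve (fun t => Real.cos (Real.pi * t))
      (fun t => -Real.sin (Real.pi * t)) (fun _ => 0) (fun _ => 0)
      (by fun_prop) (by fun_prop) (by fun_prop) (by fun_prop) (by simp))
    (Subtype.ext (by ext <;> simp)) fun t => Subtype.ext (by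
      rw [coe_covN_eq_vecMulVec, coe_pathA_trans_pathA]
      simp only [coe_unitQuatCurve, rot_quat_re_imI]
      rw [mul_left_comm]
      rfl)
  refine ⟨g, ?_, h⟩
  rw [hg]
  simp

/-- A lift of the loop `A * B` to the unit quaternions. -/
def liftAB : C(I, UnitQuat) :=
  -- The cosine changes sign at `t = 1/2`, where `A` ends. The lift goes from `1` to `-i` in the
  -- plane of `1, i`, then from `-i` to `-k` in the plane of `i, k`.
  unitQuatCurve (fun t => max (Real.cos (Real.pi * t)) 0) (fun t => -Real.sin (Real.pi * t))
    (fun _ => 0) (fun t => min (Real.cos (Real.pi * t)) 0)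
    (by fun_prop) (by fun_prop) (by fun_prop) (by fun_prop) fun t => by
      rcases le_total (Real.cos (Real.pi * t)) 0 with h | h <;> simp [h]

theorem liftAB_zero : liftAB 0 = 1 := Subtype.ext (by ext <;> simp [liftAB])

theorem coe_liftAB_one : (liftAB 1 : ℍ) = quat 0 0 0 (-1) := by
  ext <;> simp [liftAB]

theorem covN_liftAB (r : ℝ) (t : I) : covN r (liftAB t) = (pathA r).trans (pathB r) t := by
  refine Subtype.ext ?_
  have hpi := Real.pi_pos
  have ht := t.2
  rw [coe_covN_eq_vecMulVec, Path.trans_apply]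
  split_ifs with h
  · have hc : 0 ≤ Real.cos (Real.pi * t) :=
      Real.cos_nonneg_of_neg_pi_div_two_le_of_le (by nlinarith [ht.1]) (by nlinarith)
    simp only [liftAB, coe_unitQuatCurve, max_eq_left hc, min_eq_right hc,
      rot_quat_re_imI]
    rw [mul_left_comm]
    rfl
  · have hc : Real.cos (Real.pi * t) ≤ 0 :=
      Real.cos_nonpos_of_pi_div_two_le_of_le (by nlinarith) (by nlinarith [ht.2])
    simp only [liftAB, coe_unitQuatCurve, max_eq_right hc, min_eq_left hc,
      rot_quat_imI_imK]
    change _ = r • (vecMulVec (halfCircle13 (2 * t - 1)) (halfCircle13 (2 * t - 1)) -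
      vecMulVec e2 e2)
    rw [halfCircle13_sub_one]
    simp only [neg_vecMulVec, vecMulVec_neg, neg_neg]
    rw [mul_left_comm]
    rfl

theorem hasMonodromy_pathA_trans_pathB {r : ℝ} (hr : 0 < r) : ∃ g : quatStabilizer,
    ((g : UnitQuat) : ℍ) = quat 0 0 0 (-1) ∧
      HasMonodromy (covN r) (toLoop ((pathA r).trans (pathB r))) g := by
  obtain ⟨g, hg, h⟩ := exists_hasMonodromy_of_lift hr liftAB liftAB_zero (covN_liftAB r)
  exact ⟨g, by rw [hg, coe_liftAB_one], h⟩

theorem hasMonodromy_pathP (r : ℝ) :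
    HasMonodromy (covP r) (toLoop (pathP r)) (-1 : SignGroup) := by
  refine ⟨⟨fun t => ⟨WithLp.toLp 2 (halfCircle12 t), ?_⟩, ?_⟩, fun t => ?_, ?_⟩
  · rw [mem_sphere_zero_iff_norm, EuclideanSpace.norm_eq, Real.sqrt_eq_one]
    simp [halfCircle12, Fin.sum_univ_three]
  · refine Continuous.subtype_mk ((PiLp.continuous_toLp 2 _).comp (continuous_pi fun i => ?_)) _
    fin_cases i <;> simp [halfCircle12] <;> fun_prop
  · rw [toLoop_circlePt]; rfl
  · refine Subtype.ext ?_
    change WithLp.toLp 2 (halfCircle12 (1 : I)) = (-1 : ℝ) • WithLp.toLp 2 (halfCircle12 (0 : I))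
    ext i
    fin_cases i <;> simp [halfCircle12]

/-! ### A short loop in the class `H₃` -/

/-- A lift of a short loop in `H₃`: the frame rotates about a tilted axis, and about its own third
axis. -/
def shortLift : C(I, UnitQuat) :=
  unitQuatCurve (fun t => Real.cos (Real.pi * t / 2)) (fun _ => 0) (fun _ => 0)
    (fun t => Real.sin (Real.pi * t / 2))
    (by fun_prop) (by fun_prop) (by fun_prop) (by fun_prop) (by simp) *
  -- Equality in the twisted lower bound would need an axis with third component of size `2/3`; the
  -- rational axis with `4/5` and `3/5` is close enough.
  unitQuatCurve (fun t => Real.cos (Real.pi * t)) (fun t => -(4 / 5 * Real.sin (Real.pi * t)))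
    (fun _ => 0) (fun t => -(3 / 5 * Real.sin (Real.pi * t)))
    (by fun_prop) (by fun_prop) (by fun_prop) (by fun_prop) (fun t => by
      linarith [Real.sin_sq_add_cos_sq (Real.pi * t)])

theorem coe_shortLift (t : I) : (shortLift t : ℍ) =
    quat (Real.cos (Real.pi * t / 2)) 0 0 (Real.sin (Real.pi * t / 2)) *
    quat (Real.cos (Real.pi * t)) (-(4 / 5 * Real.sin (Real.pi * t))) 0
      (-(3 / 5 * Real.sin (Real.pi * t))) := rfl

theorem coe_shortLift_zero : (shortLift 0 : ℍ) = 1 := by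
  rw [coe_shortLift]
  ext <;> simp

theorem coe_shortLift_one : (shortLift 1 : ℍ) = quat 0 0 0 (-1) := by
  rw [coe_shortLift]
  ext <;> simp

/-- The first two rows of a rotation by the angle `θ` about a fixed tilted axis. -/
def tiltedRow (k : Fin 2) (θ : ℝ) : Fin 3 → ℝ :=
  ![![16 / 25 + 9 / 25 * Real.cos θ, 3 / 5 * Real.sin θ, 12 / 25 - 12 / 25 * Real.cos θ],
    ![-(3 / 5 * Real.sin θ), Real.cos θ, 4 / 5 * Real.sin θ]] k

/-- The derivative of `tiltedRow`. -/
def tiltedRowDeriv (k : Fin 2) (θ : ℝ) : Fin 3 → ℝ :=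
  ![![-(9 / 25 * Real.sin θ), 3 / 5 * Real.cos θ, 12 / 25 * Real.sin θ],
    ![-(3 / 5 * Real.cos θ), -Real.sin θ, 4 / 5 * Real.cos θ]] k

theorem hasDerivAt_tiltedRow (k : Fin 2) (i : Fin 3) (θ : ℝ) :
    HasDerivAt (fun s => tiltedRow k s i) (tiltedRowDeriv k θ i) θ := by
  have hc := Real.hasDerivAt_cos θ
  have hs := Real.hasDerivAt_sin θ
  fin_cases k <;> fin_cases i <;> simp [tiltedRow, tiltedRowDeriv]
  · simpa using (hc.const_mul (9 / 25)).const_add (16 / 25)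
  · exact hs.const_mul _
  · simpa using (hc.const_mul (12 / 25)).const_sub (12 / 25)
  · exact (hs.const_mul _).fun_neg
  · exact hc
  · exact hs.const_mul _

theorem continuous_tiltedRow (k : Fin 2) (i : Fin 3) : Continuous fun s => tiltedRow k s i :=
  continuous_iff_continuousAt.2 fun θ => (hasDerivAt_tiltedRow k i θ).continuousAt

theorem continuous_tiltedRowDeriv (k : Fin 2) (i : Fin 3) :
    Continuous fun s => tiltedRowDeriv k s i := by
  fin_cases k <;> fin_cases i <;> simp [tiltedRowDeriv] <;> fun_prop

/-- The short loop in `H₃` as a function of the angle, divided by `r`. -/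
def shortCurve (θ : ℝ) : Mat3 := of fun i j =>
  Real.cos θ * (tiltedRow 0 θ i * tiltedRow 0 θ j - tiltedRow 1 θ i * tiltedRow 1 θ j) -
    Real.sin θ * (tiltedRow 0 θ i * tiltedRow 1 θ j + tiltedRow 1 θ i * tiltedRow 0 θ j)

/-- The derivative of `shortCurve`. -/
def shortCurveDeriv (θ : ℝ) : Mat3 := of fun i j =>
  -Real.sin θ * (tiltedRow 0 θ i * tiltedRow 0 θ j - tiltedRow 1 θ i * tiltedRow 1 θ j) +
    Real.cos θ * (tiltedRowDeriv 0 θ i * tiltedRow 0 θ j + tiltedRow 0 θ i * tiltedRowDeriv 0 θ j -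
      (tiltedRowDeriv 1 θ i * tiltedRow 1 θ j + tiltedRow 1 θ i * tiltedRowDeriv 1 θ j)) -
    (Real.cos θ * (tiltedRow 0 θ i * tiltedRow 1 θ j + tiltedRow 1 θ i * tiltedRow 0 θ j) +
    Real.sin θ * (tiltedRowDeriv 0 θ i * tiltedRow 1 θ j + tiltedRow 0 θ i * tiltedRowDeriv 1 θ j +
      (tiltedRowDeriv 1 θ i * tiltedRow 0 θ j + tiltedRow 1 θ i * tiltedRowDeriv 0 θ j)))

theorem hasDerivAt_shortCurve (θ : ℝ) (i j : Fin 3) :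
    HasDerivAt (fun s => shortCurve s i j) (shortCurveDeriv θ i j) θ := by
  have h := hasDerivAt_tiltedRow
  exact ((Real.hasDerivAt_cos θ).mul
    (((h 0 i θ).mul (h 0 j θ)).sub ((h 1 i θ).mul (h 1 j θ)))).sub
    ((Real.hasDerivAt_sin θ).mul (((h 0 i θ).mul (h 1 j θ)).add ((h 1 i θ).mul (h 0 j θ))))

/-- In terms of the angle the lift has `b² + c² = (4/10)²` and `d = 1/4 - 3/10`, and `8(b² + c² +
4d²) = 34/25`. -/
theorem frobSq_shortCurveDeriv (θ : ℝ) : frobSq (shortCurveDeriv θ) = 34 / 25 := by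
  have h := Real.sin_sq_add_cos_sq θ
  simp only [frobSq, Fin.sum_univ_three, shortCurveDeriv, of_apply, tiltedRow, tiltedRowDeriv]
  simp only [cons_val_zero, cons_val_one, cons_val]
  generalize Real.sin θ = S at *
  generalize Real.cos θ = C at *
  linear_combination (34 / 25 + 594 / 625 * S ^ 2 + 466 / 625 * S ^ 4 + 34 / 25 * C ^ 2 +
    1188 / 625 * C ^ 2 * S ^ 2 + 722 / 625 * C ^ 4) * h

/-- The left factor of `shortLift` rotates the first two rows `u, v` in their plane by `πt`, hence
the pair `u⊗u - v⊗v`, `u⊗v + v⊗u` by `2πt`. -/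
theorem coe_covN_shortLift (r : ℝ) (t : I) :
    (covN r (shortLift t) : Mat3) = r • shortCurve (2 * Real.pi * t) := by
  have hx : 2 * Real.pi * t = 2 * (Real.pi * t) := by ring
  have hy : Real.pi * t = 2 * (Real.pi * t / 2) := by ring
  have hs := Real.sin_sq_add_cos_sq (Real.pi * t)
  have e : ∀ j, rot (shortLift t) 0 j =
        Real.cos (Real.pi * t) * tiltedRow 0 (2 * Real.pi * t) j -
        Real.sin (Real.pi * t) * tiltedRow 1 (2 * Real.pi * t) j ∧
      rot (shortLift t) 1 j =
        Real.sin (Real.pi * t) * tiltedRow 0 (2 * Real.pi * t) j +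
        Real.cos (Real.pi * t) * tiltedRow 1 (2 * Real.pi * t) j := by
    intro j
    have h0 : rot (quat (Real.cos (Real.pi * t)) (-(4 / 5 * Real.sin (Real.pi * t))) 0
        (-(3 / 5 * Real.sin (Real.pi * t)))) 0 j = tiltedRow 0 (2 * Real.pi * t) j := by
      rw [hx]
      fin_cases j <;> simp [rot, tiltedRow, Real.cos_two_mul', Real.sin_two_mul]
      · linear_combination (16 / 25) * hs
      · ring
      · linear_combination (12 / 25) * hs
    have h1 : rot (quat (Real.cos (Real.pi * t)) (-(4 / 5 * Real.sin (Real.pi * t))) 0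
        (-(3 / 5 * Real.sin (Real.pi * t)))) 1 j = tiltedRow 1 (2 * Real.pi * t) j := by
      rw [hx]
      fin_cases j <;> simp [rot, tiltedRow, Real.cos_two_mul', Real.sin_two_mul] <;> ring
    rw [coe_shortLift, rot_mul, Matrix.mul_apply, Matrix.mul_apply, Fin.sum_univ_three,
      Fin.sum_univ_three, h0, h1]
    generalize tiltedRow 0 (2 * Real.pi * t) j = u
    generalize tiltedRow 1 (2 * Real.pi * t) j = v
    have hc2 := Real.cos_two_mul' (Real.pi * t / 2)
    have hs2 := Real.sin_two_mul (Real.pi * t / 2)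
    rw [← hy] at hc2 hs2
    constructor
    · rw [hc2, hs2]; simp [rot, -mul_eq_mul_left_iff, -mul_eq_mul_right_iff]; ring
    · rw [hc2, hs2]; simp [rot, -mul_eq_mul_left_iff, -mul_eq_mul_right_iff]; ring
  ext i j
  rw [coe_covN, Matrix.smul_apply, Matrix.smul_apply, conjBy_baseN_apply, (e i).1, (e j).1,
    (e i).2, (e j).2]
  congr 1
  simp only [shortCurve, of_apply]
  generalize tiltedRow 0 (2 * Real.pi * t) = u
  generalize tiltedRow 1 (2 * Real.pi * t) = v
  rw [hx, Real.cos_two_mul', Real.sin_two_mul]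
  ring

/-- This keeps the segments between the two lifts away from `0`, so that they can be projected to
the sphere. -/
theorem inner_liftAB_shortLift_nonneg (t : I) :
    0 ≤ inner ℝ (liftAB t : ℍ) (shortLift t : ℍ) := by
  have ht := t.2
  have hpi := Real.pi_pos
  have hs : 0 ≤ Real.sin (Real.pi * t) :=
    Real.sin_nonneg_of_nonneg_of_le_pi (by nlinarith [ht.1]) (by nlinarith [ht.2])
  have hs2 : 0 ≤ Real.sin (Real.pi * t / 2) :=
    Real.sin_nonneg_of_nonneg_of_le_pi (by nlinarith [ht.1]) (by nlinarith [ht.2])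
  have hc2 : 0 ≤ Real.cos (Real.pi * t / 2) :=
    Real.cos_nonneg_of_neg_pi_div_two_le_of_le (by nlinarith [ht.1]) (by nlinarith [ht.2])
  rw [coe_shortLift, Quaternion.inner_def, liftAB, coe_unitQuatCurve]
  simp
  generalize Real.sin (Real.pi * t) = S at *
  generalize Real.cos (Real.pi * t) = C at *
  generalize Real.sin (Real.pi * t / 2) = s at *
  generalize Real.cos (Real.pi * t / 2) = c at *
  rcases le_total C 0 with h | h
  · rw [max_eq_right h, min_eq_left h]
    have h1 : 0 ≤ s * (C * C) := mul_nonneg hs2 (mul_self_nonneg C)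
    have h2 : 0 ≤ c * S * -C := mul_nonneg (mul_nonneg hc2 hs) (by linarith)
    have h3 : 0 ≤ S * (c * S) := mul_nonneg hs (mul_nonneg hc2 hs)
    nlinarith
  · rw [max_eq_left h, min_eq_right h]
    have h1 : 0 ≤ c * (C * C) := mul_nonneg hc2 (mul_self_nonneg C)
    have h2 : 0 ≤ s * S * C := mul_nonneg (mul_nonneg hs2 hs) h
    have h3 : 0 ≤ S * (c * S) := mul_nonneg hs (mul_nonneg hc2 hs)
    nlinarith

/-- Two curves of unit quaternions that form no obtuse angle project to homotopic loops if they
have the same end points, which lie over the same point of `𝒩`. -/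
theorem homotopic_of_inner_nonneg {r : ℝ} {p q : C(I, UnitQuat)} (h0 : p 0 = q 0)
    (h1 : p 1 = q 1) (hp : covN r (p 0) = covN r (p 1))
    (hpq : ∀ t, 0 ≤ inner ℝ (p t : ℍ) (q t : ℍ)) {β β' : Loop (mfdN r)}
    (hβ : ∀ t : I, covN r (p t) = β (circlePt t))
    (hβ' : ∀ t : I, covN r (q t) = β' (circlePt t)) : β.Homotopic β' := by
  let L : I × I → ℍ := fun z => (1 - (z.1 : ℝ)) • (p z.2 : ℍ) + (z.1 : ℝ) • (q z.2 : ℍ)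
  have hLc : Continuous L := by
    have hpc : Continuous fun t => (p t : ℍ) := continuous_subtype_val.comp p.continuous
    have hqc : Continuous fun t => (q t : ℍ) := continuous_subtype_val.comp q.continuous
    fun_prop
  -- With a nonnegative inner product, `|L|² ≥ (1 - s)² + s² > 0`.
  have hL : ∀ z, L z ≠ 0 := fun z hz => by
    have e : ‖L z‖ ^ 2 = (1 - (z.1 : ℝ)) ^ 2 + (z.1 : ℝ) ^ 2 +
        2 * (1 - (z.1 : ℝ)) * z.1 * inner ℝ (p z.2 : ℍ) (q z.2 : ℍ) := by
      simp only [L]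
      rw [norm_add_sq_real, norm_smul, norm_smul, real_inner_smul_left, real_inner_smul_right,
        norm_eq_of_mem_sphere, norm_eq_of_mem_sphere, mul_one, mul_one, Real.norm_eq_abs,
        Real.norm_eq_abs, sq_abs, sq_abs]
      ring
    rw [hz, norm_zero] at e
    have h3 : 0 ≤ 2 * (1 - (z.1 : ℝ)) * z.1 * inner ℝ (p z.2 : ℍ) (q z.2 : ℍ) :=
      mul_nonneg (mul_nonneg (by linarith [z.1.2.2]) z.1.2.1) (hpq z.2)
    nlinarith [sq_nonneg (1 - 2 * (z.1 : ℝ))]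
  have hmem : ∀ z, ‖L z‖⁻¹ • L z ∈ Metric.sphere (0 : ℍ) 1 := fun z => by
    rw [mem_sphere_zero_iff_norm, norm_smul, norm_inv, norm_norm,
      inv_mul_cancel₀ (norm_ne_zero_iff.2 (hL z))]
  have hc : Continuous fun z => ‖L z‖⁻¹ • L z :=
    (hLc.norm.inv₀ fun z => norm_ne_zero_iff.2 (hL z)).smul hLc
  let Λ : C(I × I, UnitQuat) := ⟨fun z => ⟨‖L z‖⁻¹ • L z, hmem z⟩, hc.subtype_mk hmem⟩
  have hΛ : ∀ (z : I × I) (u : UnitQuat), L z = u → Λ z = u := fun z u hu => by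
    refine Subtype.ext ?_
    change ‖L z‖⁻¹ • L z = u
    rw [hu, norm_eq_of_mem_sphere, inv_one, one_smul]
  have e0 : ∀ s, Λ (s, 0) = p 0 := fun s => hΛ _ _ (by simp [L, h0, ← add_smul])
  have e1 : ∀ s, Λ (s, 1) = p 1 := fun s => hΛ _ _ (by simp [L, h1, ← add_smul])
  refine homotopic_of_square ((⟨covN r, continuous_covN r⟩ : C(UnitQuat, mfdN r)).comp Λ)
    (fun s => ?_) (fun t => ?_) fun t => ?_
  · simp only [ContinuousMap.comp_apply, ContinuousMap.coe_mk]
    rw [e0, e1, hp]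
  · simp only [ContinuousMap.comp_apply, ContinuousMap.coe_mk]
    rw [hΛ (0, t) (p t) (by simp [L]), hβ]
  · simp only [ContinuousMap.comp_apply, ContinuousMap.coe_mk]
    rw [hΛ (1, t) (q t) (by simp [L]), hβ']

/-- The loop `A * B` itself has energy `4κ_*`, which does not give the strict inequality; it is
deformed to the shorter loop under `shortLift`. -/
theorem energy_H3_le (r : ℝ) : energy (H3 r) ≤ ENNReal.ofReal (34 / 25 * Real.pi * r ^ 2) := by
  have e0 : liftAB 0 = shortLift 0 := by
    rw [liftAB_zero]; exact Subtype.ext coe_shortLift_zero.symm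
  have e1 : liftAB 1 = shortLift 1 := Subtype.ext (by rw [coe_liftAB_one, coe_shortLift_one])
  let γ : Path (baseN r) (baseN r) :=
    { toFun := fun t => covN r (shortLift t)
      continuous_toFun := (continuous_covN r).comp shortLift.continuous
      source' := by rw [← e0, covN_liftAB, Path.source]
      target' := by rw [← e1, covN_liftAB, Path.target] }
  have hγ : ∀ t : I, covN r (shortLift t) = toLoop γ (circlePt t) := fun t => by
    rw [toLoop_circlePt]; rfl
  have hAB : ∀ t : I, covN r (liftAB t) = toLoop ((pathA r).trans (pathB r)) (circlePt t) :=
    fun t => by rw [toLoop_circlePt, covN_liftAB]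
  have hom : H3 r = freeClass (toLoop γ) := freeClass_eq_iff.2 (homotopic_of_inner_nonneg e0 e1
    (by rw [covN_liftAB, covN_liftAB, Path.source, Path.target])
    inner_liftAB_shortLift_nonneg hAB hγ)
  rw [hom]
  refine (energy_le_of_hasDerivAt (M := fun θ => r • shortCurve θ)
    (g := fun θ => r • shortCurveDeriv θ) (c := r ^ 2 * (34 / 25)) ?_ ?_ ?_ ?_).trans
    (ENNReal.ofReal_le_ofReal (le_of_eq (by ring)))
  · exact fun θ i j => (hasDerivAt_shortCurve θ i j).const_mul r
  · intro i j
    have h := continuous_tiltedRow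
    have h' := continuous_tiltedRowDeriv
    have h0i := h 0 i
    have h1i := h 1 i
    have h0j := h 0 j
    have h1j := h 1 j
    have k0i := h' 0 i
    have k1i := h' 1 i
    have k0j := h' 0 j
    have k1j := h' 1 j
    simp only [Matrix.smul_apply, shortCurveDeriv, of_apply]
    fun_prop
  · intro s
    rw [frobSq_smul, frobSq_shortCurveDeriv]
  · intro t ht
    rw [← hγ ⟨t, ht⟩]
    exact coe_covN_shortLift r ⟨t, ht⟩

/-! ### The values of the energies -/

theorem kappaStar_eq {r : ℝ} (hr : 0 < r) (p₀ : mfdP r) :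
    kappaStar p₀ = ENNReal.ofReal (Real.pi * r ^ 2 / 2) := by
  refine le_antisymm ?_ (le_decomposedEnergy_of_hasMonodromy_neg_one hr p₀ (hasMonodromy_pathP r))
  obtain ⟨q, hq⟩ := exists_conjBy_eq_of_mem_mfdP p₀.2
  have hq' : conjMap conjBy_mem_mfdP (q, baseP r) = p₀ := Subtype.ext hq
  have h := decomposedEnergy_le_energy (rotPath conjBy_mem_mfdP q hq' (pathP r))
  rw [freeClass_rotPath] at h
  exact h.trans (energy_h1_le r)

theorem freeClass_toLoop_refl (r : ℝ) : freeClass (toLoop (Path.refl (baseN r))) = H0 r := by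
  refine congrArg freeClass (ContinuousMap.ext fun z => ?_)
  obtain ⟨t, rfl⟩ := exists_eq_circlePt z
  rw [toLoop_circlePt]; rfl

/-- A rotation carries the loop to the base point `x₀` without changing its free class. -/
theorem decomposedEnergy_freeClass_le {r : ℝ} (x₀ : mfdN r) (γ : Path (baseN r) (baseN r)) :
    decomposedEnergy x₀ (freeClass (toLoop γ)) ≤ energy (freeClass (toLoop γ)) := by
  obtain ⟨q, hq⟩ := exists_conjBy_eq_of_mem_mfdN x₀.2
  have hq' : conjMap conjBy_mem_mfdN (q, baseN r) = x₀ := Subtype.ext hq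
  have h := decomposedEnergy_le_energy (rotPath conjBy_mem_mfdN q hq' γ)
  rwa [freeClass_rotPath] at h

theorem decomposedEnergy_freeClass_trans_le {r : ℝ} (x₀ : mfdN r)
    (γ γ' : Path (baseN r) (baseN r)) :
    decomposedEnergy x₀ (freeClass (toLoop (γ.trans γ'))) ≤
      energy (freeClass (toLoop γ)) + energy (freeClass (toLoop γ')) := by
  obtain ⟨q, hq⟩ := exists_conjBy_eq_of_mem_mfdN x₀.2
  have hq' : conjMap conjBy_mem_mfdN (q, baseN r) = x₀ := Subtype.ext hq
  have h := decomposedEnergy_trans_le (rotPath conjBy_mem_mfdN q hq' γ)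
    (rotPath conjBy_mem_mfdN q hq' γ')
  rwa [← rotPath_trans, freeClass_rotPath, freeClass_rotPath, freeClass_rotPath] at h

end LoopEnergy

end

/-! ### Comparison of the two sets of bounds -/

theorem lemma4p17 (r : ℝ) (hr : 0 < r)
    (p₀ : LoopEnergy.mfdP r) (x₀ : LoopEnergy.mfdN r) :
    (LoopEnergy.energy (LoopEnergy.H0 r) = 0 ∧
      LoopEnergy.energy (LoopEnergy.H1 r) = LoopEnergy.kappaStar p₀ ∧
      LoopEnergy.energy (LoopEnergy.H2 r) = LoopEnergy.kappaStar p₀ ∧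
      2 * LoopEnergy.kappaStar p₀ < LoopEnergy.energy (LoopEnergy.H3 r) ∧
      LoopEnergy.energy (LoopEnergy.H3 r) < 4 * LoopEnergy.kappaStar p₀ ∧
      LoopEnergy.energy (LoopEnergy.H4 r) = 4 * LoopEnergy.kappaStar p₀) ∧
    (LoopEnergy.decomposedEnergy x₀ (LoopEnergy.H0 r) = 0 ∧
      LoopEnergy.decomposedEnergy x₀ (LoopEnergy.H1 r) = LoopEnergy.kappaStar p₀ ∧
      LoopEnergy.decomposedEnergy x₀ (LoopEnergy.H2 r) = LoopEnergy.kappaStar p₀ ∧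
      LoopEnergy.decomposedEnergy x₀ (LoopEnergy.H3 r) = 2 * LoopEnergy.kappaStar p₀ ∧
      LoopEnergy.decomposedEnergy x₀ (LoopEnergy.H4 r) = 2 * LoopEnergy.kappaStar p₀) := by
  open LoopEnergy in
  rw [kappaStar_eq hr p₀]
  have hpi := Real.pi_pos
  have e2 : 2 * ENNReal.ofReal (Real.pi * r ^ 2 / 2) = ENNReal.ofReal (Real.pi * r ^ 2) := by
    rw [← ENNReal.ofReal_ofNat, ← ENNReal.ofReal_mul (by norm_num)]
    congr 1; ring
  have e4 : 4 * ENNReal.ofReal (Real.pi * r ^ 2 / 2) = ENNReal.ofReal (2 * Real.pi * r ^ 2) := by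
    rw [← ENNReal.ofReal_ofNat, ← ENNReal.ofReal_mul (by norm_num)]
    congr 1; ring
  have hpos : 0 < Real.pi * r ^ 2 := by positivity
  obtain ⟨gA, hgA, mA⟩ := hasMonodromy_pathA hr
  obtain ⟨gB, hgB, mB⟩ := hasMonodromy_pathB hr
  obtain ⟨gC, hgC, mC⟩ := hasMonodromy_pathA_trans_pathB hr
  obtain ⟨gD, hgD, mD⟩ := hasMonodromy_pathA_trans_pathA hr
  have lA := weight_mul_le_energy hr mA
  have lB := weight_mul_le_energy hr mB
  have lC := weight_mul_le_energy hr mC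
  have lD := weight_mul_le_energy hr mD
  have sA := starWeight_mul_le_decomposedEnergy hr x₀ mA
  have sB := starWeight_mul_le_decomposedEnergy hr x₀ mB
  have sC := starWeight_mul_le_decomposedEnergy hr x₀ mC
  have sD := starWeight_mul_le_decomposedEnergy hr x₀ mD
  rw [hgA] at lA sA
  rw [hgB] at lB sB
  rw [hgC] at lC sC
  rw [hgD] at lD sD
  simp only [weight, quat_re, quat_imI, quat_imJ, quat_imK] at lA lB lC lD
  simp only [starWeight, quat_re, quat_imI, quat_imJ, quat_imK] at sA sB sC sD
  have uA := decomposedEnergy_freeClass_le x₀ (pathA r)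
  have uB := decomposedEnergy_freeClass_le x₀ (pathB r)
  have uC := decomposedEnergy_freeClass_trans_le x₀ (pathA r) (pathB r)
  have uD := decomposedEnergy_freeClass_trans_le x₀ (pathA r) (pathA r)
  have u0 := decomposedEnergy_freeClass_le x₀ (Path.refl (baseN r))
  rw [freeClass_toLoop_refl, energy_H0] at u0
  have hA := energy_H1_le r
  have hB := energy_H2_le r
  rw [e2, e4]
  refine ⟨⟨energy_H0 r, le_antisymm hA (le_trans (le_of_eq ?_) lA),
    le_antisymm hB (le_trans (le_of_eq ?_) lB), lt_of_lt_of_le ?_ lC,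
    (energy_H3_le r).trans_lt ?_, le_antisymm (energy_H4_le r) (le_trans (le_of_eq ?_) lD)⟩,
    le_antisymm u0 zero_le, le_antisymm (uA.trans hA) (le_trans (le_of_eq ?_) sA),
    le_antisymm (uB.trans hB) (le_trans (le_of_eq ?_) sB),
    le_antisymm ((uC.trans (add_le_add hA hB)).trans (le_of_eq ?_)) (le_trans (le_of_eq ?_) sC),
    le_antisymm ((uD.trans (add_le_add hA hA)).trans (le_of_eq ?_)) (le_trans (le_of_eq ?_) sD)⟩
  · congr 1; ring
  · congr 1; ring
  -- In units of `κ_*` this is `2 < 8/3`, the weight of `-k`.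
  · rw [ENNReal.ofReal_lt_ofReal_iff_of_nonneg hpos.le]; nlinarith
  -- This is `34/25 < 2` in units of `πr²`.
  · rw [ENNReal.ofReal_lt_ofReal_iff_of_nonneg (by positivity)]; nlinarith
  · congr 1; ring
  · congr 1; ring
  · congr 1; ring
  · rw [← two_mul, e2]
  · congr 1; ring
  · rw [← two_mul, e2]
  · congr 1; ring
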